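/- A polygon is a self-avoiding polygon on the square lattice $\mathbb Z^2$, considered up to translation, and MBR denotes its minimum bounding rectangle. For $m\ge 1$, a polygon is $m$-unimodal if its perimeter exceeds the perimeter of its MBR by exactly $2m$ and it passes through the bottom-left corner of its MBR; it is $m$-staircase if it moreover passes through the top-right corner. Traverse the polygon clockwise from the bottom-left corner of the MBR; its left edge is the part of this walk up to the last vertex on the top side of the MBR. The polygon has all its indents vertical, on the left side, and at different heights if (i) its horizontal perimeter is twice the width of its MBR; (ii) after the left edge the walk makes no upward step (so the left edge contains exactly $m$ downward steps, the indents); (iii) any two downward steps of the left edge are separated by an upward step (each indent is one unit deep) and start at different heights. Put $\Delta = 1-2x-2y-2xy+x^2+y^2$, let $\sqrt\Delta$ be its formal power series square root with constant term $1$, and let $$SP=\tfrac12\bigl(1-x-y-\sqrt\Delta\bigr),\qquad UP=\frac{xy}{\sqrt\Delta},\qquad \mathcal I=\Bigl(\frac{SP}{y}\Bigr)^2 ,$$ where $SP$ and $UP$ are formal power series in $x,y$ divisible by $y$. **Proposition.** For every $m\ge1$, the generating function of $m$-staircase (resp. $m$-unimodal) polygons with all indents vertical, on the left side, and at different heights,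 in which a polygon whose MBR has width $a$ and height $b$ has weight $x^ay^b$, equals $$\frac{y^{m+1}}{m!}\,\frac{\partial^{m-1}}{\partial y^{m-1}}\left(\mathcal I^{\,m}\,\frac{\partial}{\partial y}\,\frac{\mathcal Q}{y}\right),$$ where $\mathcal Q=SP$ (resp. $\mathcal Q=UP$). For $m=2$ this is $\frac{y^3}{2}\,\partial_y\bigl(\mathcal I^2\,\partial_y(\mathcal Q/y)\bigr)$. -/

import Mathlib

namespace MConvex

/-! ### Polygons on the square lattice -/

/-- A unit step of the square lattice: north, east, south or west. -/
inductive Step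
  | N | E | S | W
  deriving DecidableEq

instance : Fintype Step := ⟨{.N, .E, .S, .W}, fun s => by cases s <;> decide⟩

/-- The displacement of a step. -/
def Step.vec : Step → ℤ × ℤ
  | .N => (0, 1)
  | .E => (1, 0)
  | .S => (0, -1)
  | .W => (-1, 0)

/-- The vertex reached after the first `k` steps of the walk `w`, which starts at the origin. -/
def pos (w : List Step) (k : ℕ) : ℤ × ℤ := ((w.take k).map Step.vec).sum

/-- `w` is the boundary walk of a self-avoiding polygon: it closes up and visits no vertex twice
before that (the degenerate walk along one edge and back is excluded by its length). -/
structure IsPolygon (w : List Step) : Prop where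
  length_ge : 4 ≤ w.length
  closed : pos w w.length = 0
  simple : ∀ i j, i < j → j < w.length → pos w i ≠ pos w j

/-- The minimum bounding rectangle of `w` is `[0, a] × [0, b]`. As the walk starts at the origin,
the left and bottom sides are reached, and the bottom-left corner lies on the walk. -/
structure HasBox (a b : ℕ) (w : List Step) : Prop where
  inside : ∀ k ≤ w.length, 0 ≤ (pos w k).1 ∧ (pos w k).1 ≤ a ∧ 0 ≤ (pos w k).2 ∧ (pos w k).2 ≤ b
  right : ∃ k ≤ w.length, (pos w k).1 = a
  top : ∃ k ≤ w.length, (pos w k).2 = b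

/-- `w` is the boundary walk of an `m`-unimodal polygon of width `a` and height `b`: a
self-avoiding polygon through the bottom-left corner of its minimum bounding rectangle, whose
perimeter exceeds that of the rectangle by `2 * m`. The walk starts at this corner and runs
clockwise (its first step is north), so every such polygon, up to translation, has exactly one
boundary walk. -/
structure IsUnimodal (m a b : ℕ) (w : List Step) : Prop where
  polygon : IsPolygon w
  box : HasBox a b w
  clockwise : w.head? = some Step.N
  perimeter : w.length = 2 * (a + b) + 2 * m

/-- An `m`-staircase polygon also passes through the top-right corner of its minimum bounding
rectangle. -/
structure IsStaircase (m a b : ℕ) (w : List Step) : Prop extends IsUnimodal m a b w where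
  corner : ∃ k ≤ w.length, pos w k = ((a : ℤ), (b : ℤ))

/-- The step number `k` (counted from zero) of `w` lies on the left edge, that is, on the part of
the clockwise boundary walk from the bottom-left corner to the last vertex on the top side of the
minimum bounding rectangle. Here `b` is the height of the rectangle. -/
def OnLeftEdge (b : ℕ) (w : List Step) (k : ℕ) : Prop :=
  ∃ j, k < j ∧ j ≤ w.length ∧ (pos w j).2 = b

/-- All indents are vertical, one unit deep, on the left edge, and at different heights.

A vertical indent on the left edge, one unit deep, is a south step there (the edge rises, makes
one south step, and rises again); its height is the ordinate of that step. -/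
structure LeftIndented (a b : ℕ) (w : List Step) : Prop where
  /-- no horizontal indents: the horizontal perimeter is that of the bounding rectangle -/
  no_horizontal : w.count Step.E = a
  /-- no vertical indents elsewhere: after the left edge, the boundary never goes up again -/
  only_left : ∀ k, w[k]? = some Step.N → OnLeftEdge b w k
  /-- each indent is one unit deep: different south steps belong to different indents -/
  depth_one : ∀ i j, i < j → w[i]? = some Step.S → w[j]? = some Step.S → OnLeftEdge b w j →
    ∃ k, i < k ∧ k < j ∧ w[k]? = some Step.N
  /-- the indents are at different heights -/
  heights : ∀ i j, i < j → w[i]? = some Step.S → w[j]? = some Step.S → OnLeftEdge b w j →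
    (pos w i).2 ≠ (pos w j).2

/-- The `m`-staircase polygons of width `a` and height `b` whose indents are all vertical, on the
left edge, and at different heights. -/
def staircaseSet (m a b : ℕ) : Set (List Step) := {w | IsStaircase m a b w ∧ LeftIndented a b w}

/-- The `m`-unimodal polygons of width `a` and height `b` whose indents are all vertical, on the
left edge, and at different heights. -/
def unimodalSet (m a b : ℕ) : Set (List Step) := {w | IsUnimodal m a b w ∧ LeftIndented a b w}

theorem unimodalSet_finite (m a b : ℕ) : (unimodalSet m a b).Finite :=
  (List.finite_length_eq Step (2 * (a + b) + 2 * m)).subset fun _ h => h.1.perimeter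

theorem staircaseSet_finite (m a b : ℕ) : (staircaseSet m a b).Finite :=
  (unimodalSet_finite m a b).subset fun _ h => ⟨h.1.toIsUnimodal, h.2⟩

/-! ### Formal power series in `x` and `y` -/

/-- Formal power series in `x` (the variable `0`) and `y` (the variable `1`). -/
abbrev Series := MvPowerSeries (Fin 2) ℚ

noncomputable section

/-- The variable `x`. -/
def x : Series := MvPowerSeries.X 0

/-- The variable `y`. -/
def y : Series := MvPowerSeries.X 1

/-- The generating function of the polygons in `staircaseSet`, by width (`x`) and height (`y`)
of the minimum bounding rectangle. -/
def staircaseGF (m : ℕ) : Series := fun n => ((staircaseSet m (n 0) (n 1)).ncard : ℚ)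

/-- The generating function of the polygons in `unimodalSet`, by width (`x`) and height (`y`)
of the minimum bounding rectangle. -/
def unimodalGF (m : ℕ) : Series := fun n => ((unimodalSet m (n 0) (n 1)).ncard : ℚ)

/-- The partial derivative with respect to `y`. -/
def dy (f : Series) : Series := MvPowerSeries.pderiv ℚ (1 : Fin 2) f

/-- Division by `y` of a series that is divisible by `y`. -/
def divY (f : Series) : Series :=
  fun n => MvPowerSeries.coeff (n + Finsupp.single (1 : Fin 2) 1) f

theorem divY_mul (g : Series) : divY (y * g) = g := by
  ext n
  change MvPowerSeries.coeff (n + Finsupp.single (1 : Fin 2) 1) (MvPowerSeries.X 1 * g) = _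
  rw [add_comm, MvPowerSeries.X, MvPowerSeries.coeff_add_monomial_mul, one_mul]

theorem y_mul_divY {f : Series} (h : y ∣ f) : y * divY f = f := by
  obtain ⟨g, rfl⟩ := h
  rw [divY_mul]

/-- The discriminant `Δ`. -/
def Δ : Series := 1 - 2 * x - 2 * y - 2 * x * y + x ^ 2 + y ^ 2

/-- The square root of `Δ` with constant term `1`: the binomial series for `√(1 + t)` at
`t = Δ - 1`. -/
def sqrtΔ : Series := (PowerSeries.binomialSeries ℚ (1 / 2 : ℚ)).subst (Δ - 1)

theorem hasSubst_Δ : PowerSeries.HasSubst (Δ - 1) :=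
  PowerSeries.HasSubst.of_constantCoeff_zero (by simp [Δ, x, y])

theorem sqrtΔ_sq : sqrtΔ ^ 2 = Δ := by
  have h : (PowerSeries.binomialSeries ℚ (1 / 2 : ℚ)) * PowerSeries.binomialSeries ℚ (1 / 2 : ℚ)
      = 1 + PowerSeries.X := by
    rw [← PowerSeries.binomialSeries_add]
    have := PowerSeries.binomialSeries_nat (R := ℚ) (A := ℚ) 1
    norm_num at this ⊢
    exact this
  rw [sq, sqrtΔ, ← PowerSeries.subst_mul hasSubst_Δ, h, PowerSeries.subst_add hasSubst_Δ,
    PowerSeries.subst_X hasSubst_Δ, ← PowerSeries.coe_substAlgHom hasSubst_Δ, map_one]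
  ring

theorem constantCoeff_sqrtΔ : MvPowerSeries.constantCoeff sqrtΔ = 1 := by
  have h := PowerSeries.constantCoeff_subst_eq_zero (R := ℚ) (a := Δ - 1) (by simp [Δ, x, y])
    (PowerSeries.binomialSeries ℚ (1 / 2 : ℚ) - 1) (by simp)
  rw [← PowerSeries.coe_substAlgHom hasSubst_Δ, map_sub, map_one,
    PowerSeries.coe_substAlgHom hasSubst_Δ, map_sub, map_one, sub_eq_zero] at h
  exact h

/-- The staircase polygon generating function. -/
def SP : Series := MvPowerSeries.C (1 / 2 : ℚ) * (1 - x - y - sqrtΔ)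

/-- The generating function of pairs of directed walks, `1 / √Δ`. -/
def Z : Series := sqrtΔ⁻¹

/-- The unimodal polygon generating function. -/
def UP : Series := x * y * Z

/-- The generating function of a one-deep indent. -/
def I : Series := divY SP ^ 2

theorem y_dvd_UP : y ∣ UP := ⟨x * Z, by rw [UP]; ring⟩

theorem SP_mul : SP * (1 - x - y - SP) = x * y := by
  have h := sqrtΔ_sq
  have h2 : (MvPowerSeries.C (1 / 2 : ℚ) : Series) * 2 = 1 := by
    rw [show (2 : Series) = MvPowerSeries.C (2 : ℚ) from (map_ofNat _ 2).symm, ← map_mul]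
    norm_num
  rw [Δ] at h
  rw [SP]
  generalize (MvPowerSeries.C (1 / 2 : ℚ) : Series) = c at *
  linear_combination (-c ^ 2) * h +
    ((2 * c + 1) * x * y - c * (1 - x - y - sqrtΔ) * (1 - x - y)) * h2

theorem y_dvd_SP : y ∣ SP := by
  have hu : IsUnit (1 - x - y - SP) := by
    rw [MvPowerSeries.isUnit_iff_constantCoeff]
    simp [SP, x, y, constantCoeff_sqrtΔ]
  rw [← hu.dvd_mul_right, SP_mul]
  exact dvd_mul_left y x

end

end MConvex

namespace MConvex

open PowerSeries

/-! ### Lagrange inversion through the inviscid Burgers equation -/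

section Burgers

variable {R : Type*} [CommRing R] [Algebra ℚ R]

/-! Cut the polygon into its left edge and its right boundary and build both from the bottom up, one
row at a time, remembering only the horizontal gap `d` between them. Every row above the first is
crossed by the left edge either once (weight `y`) or, if it holds an indent, three times (weight
`X`). Depth one and different heights say that nothing else can happen. `IsSplit.exists_grow` and
`Grow.mem_unimodalSet` turn this into a bijection.

For fixed weights the series of completed rows form a geometric progression in `d`, with some ratio
`r`. Crossing a row once sums over all larger gaps, and an indent sums two more times; with `A = r /
(1 - r)`, one crossing gives `A` and three give `A ^ 3`. So indents only replace `y` by `Y = y + X *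
A ^ 2` in the classical equations: `A * (1 - x - Y - Y * A) = x` for staircase polygons and `B * (1
- x - Y - 2 * Y * A) = x` for unimodal ones (`staircase_equation`, `unimodal_equation`).

As `X` and `y` enter only through `Y`, the derivation `∂_X - A ^ 2 * ∂_y` kills `A`, `Y` and `B`.
Hence `φ = A ^ 2` solves the inviscid Burgers equation `∂_X φ = φ * ∂_y φ`, and `∂_X B = φ * ∂_y B`.
Such a pair satisfies `∂_X ^ m B = ∂_y ^ (m - 1) (φ ^ m * ∂_y B)` (`coeff_of_burgers`). At `X = 0`
one has `φ = (SP / y) ^ 2` and `B = Q / y`; the coefficient of `X ^ m` is the claim, up to the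
factor `y ^ (m + 1)` for the first row and the `m` indented rows. -/

/-- The extension of a derivation to power series, acting on the coefficients. -/
noncomputable def coeffDeriv (d : Derivation ℚ R R) : Derivation ℚ R⟦X⟧ R⟦X⟧ :=
  Derivation.mk'
    { toFun := fun f => PowerSeries.mk fun n => d (coeff n f)
      map_add' := fun f g => by ext n; simp
      map_smul' := fun q f => by ext n; simp }
    (fun f g => by
      ext n
      simp only [LinearMap.coe_mk, AddHom.coe_mk, coeff_mk, coeff_mul, map_sum, Derivation.leibniz,
        smul_eq_mul, map_add, Finset.sum_add_distrib]
      congr 1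
      exact Finset.sum_equiv (Equiv.prodComm ℕ ℕ) (by simp [add_comm]) (by simp))

theorem coeff_coeffDeriv (d : Derivation ℚ R R) (f : R⟦X⟧) (n : ℕ) :
    coeff n (coeffDeriv d f) = d (coeff n f) := by
  simp [coeffDeriv]

theorem constantCoeff_coeffDeriv (d : Derivation ℚ R R) (f : R⟦X⟧) :
    constantCoeff (coeffDeriv d f) = d (constantCoeff f) := by
  simp only [← coeff_zero_eq_constantCoeff_apply, coeff_coeffDeriv]

theorem constantCoeff_iterate_coeffDeriv (d : Derivation ℚ R R) (f : R⟦X⟧) (n : ℕ) :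
    constantCoeff ((coeffDeriv d)^[n] f) = d^[n] (constantCoeff f) := by
  induction n generalizing f with
  | zero => rfl
  | succ n ih => rw [Function.iterate_succ_apply, ih, constantCoeff_coeffDeriv,
      Function.iterate_succ_apply]

theorem derivative_coeffDeriv (d : Derivation ℚ R R) (f : R⟦X⟧) :
    derivative R (coeffDeriv d f) = coeffDeriv d (derivative R f) := by
  ext n
  have h : d ((n : R) + 1) = 0 := by
    have := d.map_natCast (n + 1)
    push_cast at this
    exact this
  simp [coeff_coeffDeriv, coeff_derivative, h, mul_comm]

theorem derivative_iterate_coeffDeriv (d : Derivation ℚ R R) (f : R⟦X⟧) (n : ℕ) :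
    derivative R ((coeffDeriv d)^[n] f) = (coeffDeriv d)^[n] (derivative R f) := by
  induction n generalizing f with
  | zero => rfl
  | succ n ih => rw [Function.iterate_succ_apply, ih, derivative_coeffDeriv,
      Function.iterate_succ_apply]

/-- The induction step is `∂_X (φ ^ (m+1) * dB) = d (φ ^ (m+2) * dB)`: the power contributes `m + 1`
copies of `φ ^ (m+1) * dφ * dB`, and `d (φ * dB)` supplies the missing one together with the term in
`d (dB)`. -/
theorem iterate_derivative_of_burgers (d : Derivation ℚ R R) {φ B : R⟦X⟧}
    (hφ : derivative R φ = φ * coeffDeriv d φ) (hB : derivative R B = φ * coeffDeriv d B) (m : ℕ) :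
    (derivative R)^[m + 1] B = (coeffDeriv d)^[m] (φ ^ (m + 1) * coeffDeriv d B) := by
  induction m with
  | zero => simpa using hB
  | succ m ih =>
    rw [Function.iterate_succ_apply', ih, derivative_iterate_coeffDeriv,
      Function.iterate_succ_apply]
    congr 1
    simp only [Derivation.leibniz, Derivation.leibniz_pow, derivative_coeffDeriv, hB, hφ,
      smul_eq_mul, nsmul_eq_mul, Nat.add_sub_cancel]
    push_cast
    ring

theorem coeff_of_burgers (d : Derivation ℚ R R) {φ B : R⟦X⟧}
    (hφ : derivative R φ = φ * coeffDeriv d φ) (hB : derivative R B = φ * coeffDeriv d B) (m : ℕ) :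
    ((m + 1).factorial : R) * coeff (m + 1) B =
      d^[m] (constantCoeff φ ^ (m + 1) * d (constantCoeff B)) := by
  rw [← constantCoeff_iterate_derivative, iterate_derivative_of_burgers d hφ hB,
    constantCoeff_iterate_coeffDeriv, map_mul, map_pow, constantCoeff_coeffDeriv]

end Burgers

/-! ### The algebraic equations -/

/-- The series of the left edge steps: a row crossed once (`y`), or three times (marked by the
outer variable). -/
noncomputable def risingSeries (A : PowerSeries Series) : PowerSeries Series :=
  C y + X * A ^ 2

theorem constantCoeff_y : MvPowerSeries.constantCoeff y = 0 := by simp [y]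

theorem constantCoeff_x : MvPowerSeries.constantCoeff x = 0 := by simp [x]

theorem ne_zero_of_constantCoeff {f : PowerSeries Series}
    (h : MvPowerSeries.constantCoeff (constantCoeff f) = 1) : f ≠ 0 := by
  rintro rfl
  simp at h

theorem derivative_C_series (f : Series) : derivative Series (C f) = 0 := derivative_C

theorem coeffDeriv_X (d : Derivation ℚ Series Series) :
    coeffDeriv d (X : PowerSeries Series) = 0 := by
  ext1 n
  rw [coeff_coeffDeriv, coeff_X]
  split_ifs <;> simp

theorem coeffDeriv_C (d : Derivation ℚ Series Series) (f : Series) :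
    coeffDeriv d (C f : PowerSeries Series) = C (d f) := by
  ext1 n
  rw [coeff_coeffDeriv, coeff_C, coeff_C]
  split_ifs <;> simp

theorem pderiv_x : MvPowerSeries.pderiv ℚ (1 : Fin 2) x = 0 :=
  MvPowerSeries.pderiv_X_of_ne (by decide)

theorem pderiv_y : MvPowerSeries.pderiv ℚ (1 : Fin 2) y = 1 := MvPowerSeries.pderiv_X_self

/-- The derivation `∂/∂y` on the coefficients. -/
noncomputable abbrev Dy : Derivation ℚ (PowerSeries Series) (PowerSeries Series) :=
  coeffDeriv (MvPowerSeries.pderiv ℚ (1 : Fin 2))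

/-- The explicit derivatives of `risingSeries A` with respect to `X` and `y` are `A ^ 2` and `1`, so
the `X`-derivative of the equation minus `A ^ 2` times its `y`-derivative is a multiple of `∂_X A -
A ^ 2 * ∂_y A`. -/
theorem burgers_staircase {A : PowerSeries Series}
    (hA : A * (1 - C x - risingSeries A - risingSeries A * A) = C x) :
    derivative Series A = A ^ 2 * Dy A := by
  have h1 := congrArg (derivative Series) hA
  have h2 := congrArg Dy hA
  simp only [risingSeries, map_sub, map_add, Derivation.leibniz, Derivation.leibniz_pow,
    Derivation.map_one_eq_zero, derivative_C_series, derivative_X, coeffDeriv_X, coeffDeriv_C,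
    pderiv_x, pderiv_y, smul_eq_mul, nsmul_eq_mul, map_zero, map_one] at h1 h2
  -- The first factor is the derivative of the equation with respect to `A`; its constant term is
  -- `1`, so it cancels.
  have key : (1 - C x - risingSeries A - 2 * risingSeries A * A - 2 * X * A ^ 2 * (1 + A)) *
      (derivative Series A - A ^ 2 * Dy A) = 0 := by
    rw [risingSeries]
    push_cast at h1 h2
    linear_combination h1 - A ^ 2 * h2
  rcases mul_eq_zero.1 key with h | h
  · exact absurd h (ne_zero_of_constantCoeff (by
      simp [risingSeries, constantCoeff_x, constantCoeff_y]))
  · exact sub_eq_zero.1 h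

/-- The derivation `∂_X - A ^ 2 * ∂_y` kills `A` and `risingSeries A`, hence also the solution `B`
of a linear equation with coefficients in these and `x`. -/
theorem burgers_unimodal {A B : PowerSeries Series}
    (hA : A * (1 - C x - risingSeries A - risingSeries A * A) = C x)
    (hB : B * (1 - C x - risingSeries A - 2 * risingSeries A * A) = C x) :
    derivative Series B = A ^ 2 * Dy B := by
  have h0 := burgers_staircase hA
  have h1 := congrArg (derivative Series) hB
  have h2 := congrArg Dy hB
  have e2 : derivative Series (2 : PowerSeries Series) = 0 := (derivative Series).map_natCast 2
  have e3 : Dy (2 : PowerSeries Series) = 0 := Dy.map_natCast 2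
  simp only [risingSeries, map_sub, map_add, Derivation.leibniz, Derivation.leibniz_pow,
    Derivation.map_one_eq_zero, derivative_C_series, derivative_X, coeffDeriv_X, coeffDeriv_C,
    pderiv_x, pderiv_y, smul_eq_mul, nsmul_eq_mul, map_zero, map_one, h0, e2, e3] at h1 h2
  have key : (1 - C x - risingSeries A - 2 * risingSeries A * A) *
      (derivative Series B - A ^ 2 * Dy B) = 0 := by
    rw [risingSeries]
    push_cast at h1 h2
    linear_combination h1 - A ^ 2 * h2
  rcases mul_eq_zero.1 key with h | h
  · exact absurd h (ne_zero_of_constantCoeff (by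
      simp [risingSeries, constantCoeff_x, constantCoeff_y]))
  · exact sub_eq_zero.1 h

theorem constantCoeff_eq_divY_SP {A : PowerSeries Series}
    (hA : A * (1 - C x - risingSeries A - risingSeries A * A) = C x) :
    constantCoeff A = divY SP := by
  have h := congrArg constantCoeff hA
  simp only [risingSeries, map_mul, map_sub, map_add, map_one, constantCoeff_C, constantCoeff_X,
    map_pow, zero_mul, add_zero] at h
  generalize constantCoeff A = S at h
  have h2 := SP_mul
  have e := y_mul_divY y_dvd_SP
  -- `y * S` and `SP` are roots of the same quadratic `T * (1 - x - y - T) = x * y`. The second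
  -- factor has constant term `1`, so the two roots agree.
  have key : (y * S - SP) * (1 - x - y - y * S - SP) = 0 := by linear_combination y * h - h2
  rcases mul_eq_zero.1 key with h3 | h3
  · rw [← sub_eq_zero.1 h3, divY_mul]
  · have := congrArg MvPowerSeries.constantCoeff h3
    simp [constantCoeff_x, constantCoeff_y, SP, constantCoeff_sqrtΔ] at this

/-- At `X = 0` the coefficient of `B` becomes `1 - x - y - 2 * SP`, which is `sqrtΔ`. -/
theorem constantCoeff_eq_divY_UP {A B : PowerSeries Series}
    (hA : A * (1 - C x - risingSeries A - risingSeries A * A) = C x)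
    (hB : B * (1 - C x - risingSeries A - 2 * risingSeries A * A) = C x) :
    constantCoeff B = divY UP := by
  have h := congrArg constantCoeff hB
  simp only [risingSeries, map_mul, map_sub, map_add, map_one, constantCoeff_C, constantCoeff_X,
    map_pow, zero_mul, add_zero, map_ofNat, constantCoeff_eq_divY_SP hA] at h
  have e := y_mul_divY y_dvd_SP
  have hs : sqrtΔ * sqrtΔ⁻¹ = 1 :=
    MvPowerSeries.mul_inv_cancel _ (by rw [constantCoeff_sqrtΔ]; exact one_ne_zero)
  have hc : (MvPowerSeries.C (1 / 2 : ℚ) : Series) * 2 = 1 := by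
    rw [show (2 : Series) = MvPowerSeries.C (2 : ℚ) from (map_ofNat _ 2).symm, ← map_mul]
    norm_num
  have h4 : sqrtΔ = 1 - x - y - 2 * SP := by
    rw [SP]
    linear_combination (1 - x - y - sqrtΔ) * hc
  have : UP = y * (x * Z) := by rw [UP]; ring
  rw [this, divY_mul, Z]
  linear_combination sqrtΔ⁻¹ * h - constantCoeff B * hs + constantCoeff B * sqrtΔ⁻¹ * h4 +
    2 * constantCoeff B * sqrtΔ⁻¹ * e

theorem coeff_eq_of_burgers {A B : PowerSeries Series} {Q : Series}
    (hA : A * (1 - C x - risingSeries A - risingSeries A * A) = C x)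
    (hB : derivative Series B = A ^ 2 * Dy B) (hQ : constantCoeff B = divY Q) (m : ℕ) :
    coeff (m + 1) B = MvPowerSeries.C (1 / ((m + 1).factorial : ℚ)) *
      dy^[m] (I ^ (m + 1) * dy (divY Q)) := by
  have h0 := burgers_staircase hA
  -- `A` is transported with speed `A ^ 2`, hence so is every power of `A`; for the speed itself
  -- this is Burgers' equation.
  have hφ : derivative Series (A ^ 2) = A ^ 2 * Dy (A ^ 2) := by
    simp only [Derivation.leibniz_pow, smul_eq_mul, nsmul_eq_mul, h0]
    ring
  have h := coeff_of_burgers _ hφ hB m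
  rw [map_pow, constantCoeff_eq_divY_SP hA, hQ] at h
  have hdy : (⇑(MvPowerSeries.pderiv ℚ (1 : Fin 2)) : Series → Series) = dy := rfl
  rw [hdy] at h
  change _ = dy^[m] (I ^ (m + 1) * _) at h
  rw [← h, ← mul_assoc, show (((m + 1).factorial : ℕ) : Series) =
    MvPowerSeries.C ((m + 1).factorial : ℚ) from (map_natCast _ _).symm, ← map_mul,
    one_div_mul_cancel (by exact_mod_cast (m + 1).factorial_ne_zero), map_one, one_mul]

end MConvex

namespace MConvex

open PowerSeries

/-! ### Uniqueness of solutions of the linear recursions -/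

/-- All coefficients of total degree less than `n` vanish. -/
def HasOrderGE (n : ℕ) (f : PowerSeries Series) : Prop :=
  ∀ m (e : Fin 2 →₀ ℕ), m + e 0 + e 1 < n → MvPowerSeries.coeff e (coeff m f) = 0

namespace HasOrderGE

variable {k n : ℕ} {f g : PowerSeries Series}

theorem of_le (h : HasOrderGE n f) (hk : k ≤ n) : HasOrderGE k f :=
  fun m e he => h m e (he.trans_le hk)

theorem zero : HasOrderGE 0 f := fun _ _ h => absurd h (Nat.not_lt_zero _)

theorem add (hf : HasOrderGE n f) (hg : HasOrderGE n g) : HasOrderGE n (f + g) :=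
  fun m e he => by rw [map_add, map_add, hf m e he, hg m e he, add_zero]

theorem sub (hf : HasOrderGE n f) (hg : HasOrderGE n g) : HasOrderGE n (f - g) :=
  fun m e he => by rw [map_sub, map_sub, hf m e he, hg m e he, sub_zero]

theorem mul (hf : HasOrderGE k f) (hg : HasOrderGE n g) : HasOrderGE (k + n) (f * g) := by
  classical
  intro m e he
  rw [coeff_mul, map_sum]
  refine Finset.sum_eq_zero fun p hp => ?_
  rw [MvPowerSeries.coeff_mul]
  refine Finset.sum_eq_zero fun q hq => ?_
  have h1 := Finset.HasAntidiagonal.mem_antidiagonal.1 hp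
  have h2 := Finset.HasAntidiagonal.mem_antidiagonal.1 hq
  have h3 : q.1 0 + q.2 0 = e 0 := by rw [← h2]; rfl
  have h4 : q.1 1 + q.2 1 = e 1 := by rw [← h2]; rfl
  by_cases h : p.1 + q.1 0 + q.1 1 < k
  · rw [hf _ _ h, zero_mul]
  · rw [hg p.2 q.2 (by omega), mul_zero]

theorem mul_left (hg : HasOrderGE n g) : HasOrderGE n (f * g) := by
  simpa using (zero (f := f)).mul hg

theorem C_x : HasOrderGE 1 (C x) := by
  classical
  intro m e he
  rw [coeff_C]
  split_ifs
  · rw [x, MvPowerSeries.coeff_X, if_neg]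
    rintro rfl
    simp at he
  · simp

theorem C_y : HasOrderGE 1 (C y) := by
  classical
  intro m e he
  rw [coeff_C]
  split_ifs
  · rw [y, MvPowerSeries.coeff_X, if_neg]
    rintro rfl
    simp at he
  · simp

theorem X : HasOrderGE 1 (X : PowerSeries Series) := by
  intro m e he
  rw [coeff_X, if_neg (by omega), map_zero]

theorem eq_zero (h : ∀ n, HasOrderGE n f) : f = 0 := by
  ext m e
  simpa using h (m + e 0 + e 1 + 1) m e (by omega)

/-- After `n` uses of the relation the remainder `u (d + n)` has order at least `n`: this is
convergence of the infinite sum of the `v` over all larger gaps. -/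
theorem of_telescope {u v : ℕ → PowerSeries Series} (hv : ∀ d, HasOrderGE n (v d))
    (h : ∀ d, u d = v d + u (d + 1)) (hu : ∀ d, HasOrderGE d (u d)) (d : ℕ) :
    HasOrderGE n (u d) := by
  have key : ∀ j, HasOrderGE n (u (d + j)) → HasOrderGE n (u d) := by
    intro j
    induction j with
    | zero => exact id
    | succ j ih =>
      intro hj
      exact ih (h (d + j) ▸ (hv _).add hj)
  exact key n ((hu _).of_le (by omega))

end HasOrderGE

/-- The recursions between the generating functions of one phase: rows completed (`g`), a new row
entered (`u`), going down in an indent from the upper (`v`) and on the lower (`w`) level. The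
series `h` is the inhomogeneity. -/
structure RowSystem (u v w h : ℕ → PowerSeries Series) (g : ℕ → PowerSeries Series) : Prop where
  u_eq : ∀ d, u d = g (d + 1) + u (d + 1)
  v_eq : ∀ d, v d = u (d + 1) + v (d + 1)
  w_eq : ∀ d, w d = v (d + 1) + w (d + 1)
  h_eq : ∀ d, h d = C y * u d + X * w d
  u_low : ∀ d, HasOrderGE d (u d)
  v_low : ∀ d, HasOrderGE d (v d)
  w_low : ∀ d, HasOrderGE d (w d)

namespace RowSystem

variable {u v w h g : ℕ → PowerSeries Series}

/-- The shifted system minus `r` times the system. -/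
theorem shift_sub (H : RowSystem u v w h g) (r : PowerSeries Series) :
    RowSystem (fun d => u (d + 1) - r * u d) (fun d => v (d + 1) - r * v d)
      (fun d => w (d + 1) - r * w d) (fun d => h (d + 1) - r * h d)
      (fun d => g (d + 1) - r * g d) where
  u_eq d := by rw [H.u_eq d, H.u_eq (d + 1)]; ring
  v_eq d := by rw [H.v_eq d, H.v_eq (d + 1)]; ring
  w_eq d := by rw [H.w_eq d, H.w_eq (d + 1)]; ring
  h_eq d := by rw [H.h_eq d, H.h_eq (d + 1)]; ring
  u_low d := ((H.u_low _).of_le (by omega)).sub (H.u_low d).mul_left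
  v_low d := ((H.v_low _).of_le (by omega)).sub (H.v_low d).mul_left
  w_low d := ((H.w_low _).of_le (by omega)).sub (H.w_low d).mul_left

/-- Summing over larger gaps does not lower the order, and the factors `y` and `X` in `h` raise it
by one. This gain drives both uniqueness arguments below. -/
theorem order_h (H : RowSystem u v w h g) {n : ℕ} (hg : ∀ d, HasOrderGE n (g (d + 1))) (d : ℕ) :
    HasOrderGE (n + 1) (h d) := by
  have hu := HasOrderGE.of_telescope hg H.u_eq H.u_low
  have hv := HasOrderGE.of_telescope (fun d => hu (d + 1)) H.v_eq H.v_low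
  have hw := HasOrderGE.of_telescope (fun d => hv (d + 1)) H.w_eq H.w_low
  rw [H.h_eq, add_comm n]
  exact (HasOrderGE.C_y.mul (hu d)).add (HasOrderGE.X.mul (hw d))

theorem eq_zero (H : RowSystem u v w h g) (hg : ∀ d, g (d + 1) = 0) :
    (∀ d, u d = 0) ∧ (∀ d, v d = 0) ∧ (∀ d, w d = 0) ∧ ∀ d, h d = 0 := by
  have h0 : ∀ n d, HasOrderGE n (g (d + 1)) := fun n d => by
    rw [hg]; intro _ _ _; simp
  have hu := fun n => HasOrderGE.of_telescope (h0 n) H.u_eq H.u_low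
  have hv := fun n => HasOrderGE.of_telescope (fun d => hu n (d + 1)) H.v_eq H.v_low
  have hw := fun n => HasOrderGE.of_telescope (fun d => hv n (d + 1)) H.w_eq H.w_low
  have hu' := fun d => HasOrderGE.eq_zero fun n => hu n d
  have hw' := fun d => HasOrderGE.eq_zero fun n => hw n d
  exact ⟨hu', fun d => HasOrderGE.eq_zero fun n => hv n d, hw', fun d => by
    rw [H.h_eq, hu', hw', mul_zero, mul_zero, add_zero]⟩

/-- When the rows completed form a geometric progression, so do all other series. -/
theorem geometric (H : RowSystem u v w h g) {r : PowerSeries Series}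
    (hg : ∀ d, g (d + 2) = r * g (d + 1)) :
    (∀ d, u (d + 1) = r * u d) ∧ (∀ d, v (d + 1) = r * v d) ∧ (∀ d, w (d + 1) = r * w d) ∧
      ∀ d, h (d + 1) = r * h d := by
  obtain ⟨h1, h2, h3, h4⟩ := (H.shift_sub r).eq_zero fun d => sub_eq_zero.2 (hg d)
  exact ⟨fun d => sub_eq_zero.1 (h1 d), fun d => sub_eq_zero.1 (h2 d),
    fun d => sub_eq_zero.1 (h3 d), fun d => sub_eq_zero.1 (h4 d)⟩

end RowSystem

/-- In the first phase (the right boundary moves to the right) the rows completed form a geometric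
progression. -/
theorem geometric_of_increasing {u v w h g : ℕ → PowerSeries Series} (H : RowSystem u v w h g)
    (g0 : g 0 = 1) (hg : ∀ d, g (d + 1) = C x * g d + h d) (d : ℕ) :
    g (d + 1) = g 1 * g d := by
  have Hs := H.shift_sub (g 1)
  -- The defect from a geometric progression solves the same linear system, with initial value zero;
  -- each pass through the system gains one order.
  have key : ∀ n d, HasOrderGE n (g (d + 1) - g 1 * g d) := by
    intro n
    induction n with
    | zero => exact fun d => HasOrderGE.zero
    | succ n ih =>
      intro d
      cases d with
      | zero => rw [g0, mul_one, sub_self]; intro _ _ _; simp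
      | succ d =>
        have e : g (d + 1 + 1) - g 1 * g (d + 1) =
            C x * (g (d + 1) - g 1 * g d) + (h (d + 1) - g 1 * h d) := by
          linear_combination hg (d + 1) - g 1 * hg d
        rw [e]
        refine HasOrderGE.add ?_ (Hs.order_h (fun d => ih (d + 1)) d)
        rw [add_comm n]
        exact HasOrderGE.C_x.mul (ih d)
  exact sub_eq_zero.1 (HasOrderGE.eq_zero fun n => key n d)

/-- In the second phase (the right boundary moves to the left) the rows completed form a geometric
progression, with the same ratio as the first phase. -/
theorem geometric_of_decreasing {u v w h g h' : ℕ → PowerSeries Series} {r : PowerSeries Series}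
    (H : RowSystem u v w h (fun d => g (d - 1)))
    (hr : ∀ d, h' (d + 1) = r * h' d) (g_low : ∀ d, HasOrderGE d (g d))
    (hg : ∀ d, g d = g (d + 1) + h' (d + 1) + h d) (d : ℕ) : g (d + 1) = r * g d := by
  have Hs := H.shift_sub r
  have key : ∀ n d, HasOrderGE n (g (d + 1) - r * g d) := by
    intro n
    induction n with
    | zero => exact fun d => HasOrderGE.zero
    | succ n ih =>
      -- The contribution `h'` of the first phase is already geometric and drops out of the defect.
      refine HasOrderGE.of_telescope (v := fun d => h (d + 1) - r * h d) ?_ ?_ ?_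
      · exact Hs.order_h fun d => by simpa using ih d
      · intro d
        rw [hg d, hg (d + 1), hr]
        ring
      · intro d
        exact ((g_low _).of_le (by omega)).sub (g_low d).mul_left
  exact sub_eq_zero.1 (HasOrderGE.eq_zero fun n => key n d)

theorem one_sub_mul_one_add {r A : PowerSeries Series} (h : A = r + r * A) :
    (1 - r) * (1 + A) = 1 := by linear_combination h

theorem cancel_one_sub {r A B D : PowerSeries Series} (h : A = r + r * A) (hB : B = D + r * B) :
    B = (1 + A) * D := by
  linear_combination (1 + A) * hB - B * one_sub_mul_one_add h

/-- With ratio `r = g 1`, each sum over larger gaps is multiplication by `r / (1 - r) = u 0`, so `v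
0 = u 0 ^ 2` and `w 0 = u 0 ^ 3`. Together with `r = x + h 0` this closes the system. -/
theorem staircase_equation {u v w h g : ℕ → PowerSeries Series} (H : RowSystem u v w h g)
    (g0 : g 0 = 1) (hg : ∀ d, g (d + 1) = C x * g d + h d) :
    u 0 = g 1 + g 1 * u 0 ∧ h 0 = risingSeries (u 0) * u 0 ∧
    u 0 * (1 - C x - risingSeries (u 0) - risingSeries (u 0) * u 0) = C x := by
  have hr := geometric_of_increasing H g0 hg
  obtain ⟨hu, hv, hw, -⟩ := H.geometric fun d => hr (d + 1)
  have h1 : u 0 = g 1 + g 1 * u 0 := by rw [← hu]; exact H.u_eq 0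
  have h2 : v 0 = (1 + u 0) * (g 1 * u 0) :=
    cancel_one_sub h1 (by rw [← hu, ← hv]; exact H.v_eq 0)
  have h3 : w 0 = (1 + u 0) * (g 1 * v 0) :=
    cancel_one_sub h1 (by rw [← hv, ← hw]; exact H.w_eq 0)
  have h4 : g 1 = C x + h 0 := by rw [hg 0, g0, mul_one]
  have h5 := H.h_eq 0
  have e : (1 + u 0) * g 1 = u 0 := by linear_combination -h1
  have h2' : v 0 = u 0 ^ 2 := by linear_combination h2 + u 0 * e
  have h3' : w 0 = u 0 ^ 3 := by linear_combination h3 + v 0 * e + u 0 * h2'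
  have h6 : h 0 = risingSeries (u 0) * u 0 := by
    rw [h5, h3', risingSeries]; ring
  refine ⟨h1, h6, ?_⟩
  linear_combination -e + (1 + u 0) * h4 + (1 + u 0) * h6

/-- The second phase has the same ratio, so its series are again powers of `u 0` times `u' 0`; what
remains is one linear equation for `u' 0`. -/
theorem unimodal_equation {u v w h g u' v' w' h' g' : ℕ → PowerSeries Series}
    (H : RowSystem u v w h g) (g0 : g 0 = 1) (hg : ∀ d, g (d + 1) = C x * g d + h d)
    (H' : RowSystem u' v' w' h' (fun d => g' (d - 1)))
    (hg' : ∀ d, g' d = g' (d + 1) + h (d + 1) + h' d) (g_low : ∀ d, HasOrderGE d (g' d)) :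
    (u 0 + u' 0) * (1 - C x - risingSeries (u 0) - 2 * risingSeries (u 0) * u 0) = C x := by
  obtain ⟨h1, h6, hA⟩ := staircase_equation H g0 hg
  have hr := geometric_of_increasing H g0 hg
  obtain ⟨-, -, -, hh⟩ := H.geometric fun d => hr (d + 1)
  have hr' := geometric_of_decreasing H' hh g_low hg'
  obtain ⟨hu, hv, hw, -⟩ := H'.geometric (r := g 1) fun d => hr' d
  have k1 : u' 0 = (1 + u 0) * g' 0 :=
    cancel_one_sub h1 (by rw [← hu]; exact H'.u_eq 0)
  have k2 : v' 0 = (1 + u 0) * (g 1 * u' 0) :=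
    cancel_one_sub h1 (by rw [← hu, ← hv]; exact H'.v_eq 0)
  have k3 : w' 0 = (1 + u 0) * (g 1 * v' 0) :=
    cancel_one_sub h1 (by rw [← hv, ← hw]; exact H'.w_eq 0)
  have k4 := hg' 0
  rw [hr', hh] at k4
  have k5 := H'.h_eq 0
  have e : (1 + u 0) * g 1 = u 0 := by linear_combination -h1
  have k2' : v' 0 = u 0 * u' 0 := by linear_combination k2 + u' 0 * e
  have k3' : w' 0 = u 0 ^ 2 * u' 0 := by linear_combination k3 + v' 0 * e + u 0 * k2'
  have k6 : h' 0 = risingSeries (u 0) * u' 0 := by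
    rw [k5, k3', risingSeries]; ring
  have k7 : g' 0 = (1 + u 0) * (g 1 * h 0 + h' 0) :=
    cancel_one_sub h1 (by linear_combination k4)
  generalize u 0 = A at *
  generalize u' 0 = K at *
  generalize risingSeries A = Y at *
  -- The right boundary turned either in the last completed row (term `Y * A`) or further down (term
  -- `Y * K`).
  have k8 : K = (1 + A) * (A * (Y * A) + (1 + A) * (Y * K)) := by
    linear_combination k1 + (1 + A) * k7 + (1 + A) * (1 + A) * g 1 * h6 +
      (1 + A) * (1 + A) * k6 + (1 + A) * (Y * A) * e
  have c := one_sub_mul_one_add h1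
  have k9 : 1 - C x - Y - 2 * Y * A = 1 - g 1 - Y * (1 + A) := by
    linear_combination (1 - g 1) * hA - (1 - C x - Y * A) * c
  linear_combination hA + K * k9 + (1 - g 1) * k8 +
    (Y * A ^ 2 + Y * (1 + A) * K) * c

end MConvex

namespace MConvex

open PowerSeries

/-! ### Growing a polygon row by row -/

/-- The stages in the construction of a polygon from the bottom to the top. The Boolean tells
whether the right boundary has begun to move to the left. -/
inductive Stage
  /-- the right boundary of the last row is at its final place and has only moved to the right -/
  | widening
  /-- the right boundary of the last row is at its place and has begun to move to the left -/
  | shrinking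
  /-- the right boundary has been extended to the next row -/
  | entered (b : Bool)
  /-- the left edge is on the upper level of an indent -/
  | upper (b : Bool)
  /-- the left edge is on the lower level of an indent, after the step down -/
  | lower (b : Bool)
  /-- the left edge has just been extended to the top of the new row -/
  | raised (b : Bool)

open Step Stage

/-- `Grow s d a p m L R`: the reversed initial part `L` and the final part `R` of a boundary walk
are the left edge and the right boundary of the rows up to some height. The polygon has width at
least `a`, `p` of its rows above the first are crossed once, and `m` three times by the left edge.
The gap between the end of `L` and the start of `R` is `d` in stage `widening`, and `d + 1` in the
other stages. -/
inductive Grow : Stage → ℕ → ℕ → ℕ → ℕ → List Step → List Step → Prop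
  | base : Grow widening 0 0 0 0 [N] []
  | widen {d a p m L R} : Grow widening d a p m L R → Grow widening (d + 1) (a + 1) p m L (W :: R)
  | settle {d a p m L R} : Grow (raised false) d a p m L R → Grow widening (d + 1) a p m L R
  | enterWide {d a p m L R} : Grow widening (d + 1) a p m L R →
      Grow (entered false) d a p m L (S :: R)
  | enterShrink {d a p m L R} : Grow shrinking d a p m L R → Grow (entered true) d a p m L (S :: R)
  | east {b d a p m L R} : Grow (entered b) (d + 1) a p m L R → Grow (entered b) d a p m (E :: L) R
  | indent {b d a p m L R} : Grow (entered b) (d + 1) a p m L R →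
      Grow (upper b) d a p m (E :: N :: L) R
  | eastUpper {b d a p m L R} : Grow (upper b) (d + 1) a p m L R → Grow (upper b) d a p m (E :: L) R
  | descend {b d a p m L R} : Grow (upper b) (d + 1) a p m L R →
      Grow (lower b) d a p m (E :: S :: L) R
  | eastLower {b d a p m L R} : Grow (lower b) (d + 1) a p m L R → Grow (lower b) d a p m (E :: L) R
  | raise {b d a p m L R} : Grow (entered b) d a p m L R → Grow (raised b) d a (p + 1) m (N :: L) R
  | raiseIndent {b d a p m L R} : Grow (lower b) d a p m L R →
      Grow (raised b) d a p (m + 1) (N :: L) R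
  | turn {d a p m L R} : Grow (raised false) (d + 1) a p m L R → Grow shrinking d a p m L (E :: R)
  | shrink {d a p m L R} : Grow shrinking (d + 1) a p m L R → Grow shrinking d a p m L (E :: R)
  | keep {d a p m L R} : Grow (raised true) d a p m L R → Grow shrinking d a p m L R

/-- The traits of the two walks by which the last step of the construction is recognized. -/
def Shape : Stage → List Step → List Step → Prop
  | widening, L, R => L.head? = some N ∧ E ∉ R
  | shrinking, L, R => L.head? = some N ∧ E ∈ R
  | entered b, L, R => (L.dropWhile (· = E)).head? = some N ∧ R.head? = some S ∧ (E ∈ R ↔ b)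
  | upper b, L, R => L.head? = some E ∧ R.head? = some S ∧ (E ∈ R ↔ b)
  | lower b, L, R => L.head? = some E ∧ (L.dropWhile (· = E)).head? = some S ∧
      R.head? = some S ∧ (E ∈ R ↔ b)
  | raised b, L, R => L.head? = some N ∧ R.head? = some S ∧ (E ∈ R ↔ b)

/-- Makes the construction unambiguous: in the recursions below, the images of two rules that lead
to the same stage are separated by these traits. -/
theorem Grow.shape {s d a p m L R} (h : Grow s d a p m L R) : Shape s L R := by
  induction h with
  | enterWide _ ih | enterShrink _ ih =>
    obtain ⟨h1, h2⟩ := ih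
    obtain ⟨L', rfl⟩ := List.head?_eq_some_iff.1 h1
    simp_all [Shape]
  | _ => simp_all [Shape]

/-- The bound for the length of the walks, in terms of the stage. -/
def Stage.slack : Stage → ℕ
  | widening | shrinking | raised _ => 1
  | entered _ => 2
  | upper _ => 3
  | lower _ => 4

/-- The difference between the gap and the parameter `d` in `Grow`. -/
def Stage.offset : Stage → ℕ
  | widening => 0
  | _ => 1

theorem Grow.length_le {s d a p m L R} (h : Grow s d a p m L R) :
    L.length + R.length + (d + s.offset) ≤ 2 * a + 2 * p + 4 * m + s.slack := by
  induction h <;> simp only [Stage.slack, Stage.offset, List.length_cons, List.length_nil] at * <;>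
    omega

/-- Gives the series with gap `d` order at least `d`, which makes the sums over all gaps converge.
-/
theorem Grow.le_width {s d a p m L R} (h : Grow s d a p m L R) : d + s.offset ≤ a := by
  induction h <;> simp only [Stage.offset] at * <;> omega

/-- The pairs of walks in a given stage. -/
def growSet (s : Stage) (d a p m : ℕ) : Set (List Step × List Step) :=
  {q | Grow s d a p m q.1 q.2}

theorem growSet_finite (s : Stage) (d a p m : ℕ) : (growSet s d a p m).Finite := by
  refine ((List.finite_length_le Step (2 * a + 2 * p + 4 * m + s.slack)).prod
    (List.finite_length_le Step (2 * a + 2 * p + 4 * m + s.slack))).subset fun q hq => ?_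
  have := Grow.length_le hq
  exact ⟨by simp only [Set.mem_ofPred_eq]; omega, by simp only [Set.mem_ofPred_eq]; omega⟩

/-- The number of pairs of walks in a given stage. -/
noncomputable def growCount (s : Stage) (d a p m : ℕ) : ℕ := (growSet s d a p m).ncard

theorem ncard_eq_add {α β γ : Type*} {U : Set γ} {A : Set α} {B : Set β} {f : α → γ} {g : β → γ}
    (hf : Function.Injective f) (hg : Function.Injective g) (hA : A.Finite) (hB : B.Finite)
    (hU : ∀ u, u ∈ U ↔ u ∈ f '' A ∨ u ∈ g '' B) (hd : ∀ a ∈ A, ∀ b ∈ B, f a ≠ g b) :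
    U.ncard = A.ncard + B.ncard := by
  have : U = f '' A ∪ g '' B := Set.ext hU
  rw [this, Set.ncard_union_eq _ (hA.image f) (hB.image g), Set.ncard_image_of_injective _ hf,
    Set.ncard_image_of_injective _ hg]
  rw [Set.disjoint_left]
  rintro _ ⟨a, ha, rfl⟩ ⟨b, hb, h⟩
  exact hd a ha b hb h.symm

theorem ncard_eq_of_image {α γ : Type*} {U : Set γ} {A : Set α} {f : α → γ}
    (hf : Function.Injective f) (hU : ∀ u, u ∈ U ↔ u ∈ f '' A) : U.ncard = A.ncard := by
  rw [show U = f '' A from Set.ext hU, Set.ncard_image_of_injective _ hf]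

/-- Extending the left walk. -/
def consL (l : List Step) (q : List Step × List Step) : List Step × List Step := (l ++ q.1, q.2)

/-- Extending the right walk. -/
def consR (l : List Step) (q : List Step × List Step) : List Step × List Step := (q.1, l ++ q.2)

theorem consL_injective (l : List Step) : Function.Injective (consL l) := by
  rintro ⟨a, b⟩ ⟨c, d⟩ h
  simpa [consL] using h

theorem consR_injective (l : List Step) : Function.Injective (consR l) := by
  rintro ⟨a, b⟩ ⟨c, d⟩ h
  simpa [consR] using h

/-! ### Recursions for the numbers of pairs of walks -/

section Recursions

variable (b : Bool) (d a p m : ℕ)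

theorem growCount_widening_zero :
    growCount widening 0 a p m = if a = 0 ∧ p = 0 ∧ m = 0 then 1 else 0 := by
  split_ifs with h
  · obtain ⟨rfl, rfl, rfl⟩ := h
    rw [growCount, show growSet widening 0 0 0 0 = {([N], [])} from ?_, Set.ncard_singleton]
    ext ⟨L, R⟩
    simp only [growSet, Set.mem_ofPred_eq, Set.mem_singleton_iff, Prod.mk.injEq]
    exact ⟨fun h => by cases h; simp, fun h => by rw [h.1, h.2]; exact .base⟩
  · rw [growCount, show growSet widening 0 a p m = ∅ from ?_, Set.ncard_empty]
    ext ⟨L, R⟩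
    simp only [growSet, Set.mem_ofPred_eq, Set.mem_empty_iff_false, iff_false]
    rintro ⟨⟩
    exact h ⟨rfl, rfl, rfl⟩

theorem growCount_widening_succ_zero :
    growCount widening (d + 1) 0 p m = growCount (raised false) d 0 p m := by
  rw [growCount, growCount]
  congr 1
  ext ⟨L, R⟩
  exact ⟨fun h => by cases h; assumption, .settle⟩

theorem growCount_widening_succ_succ :
    growCount widening (d + 1) (a + 1) p m =
      growCount widening d a p m + growCount (raised false) d (a + 1) p m := by
  refine ncard_eq_add (consR_injective [W]) Function.injective_id (growSet_finite ..)
    (growSet_finite ..) ?_ ?_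
  · rintro ⟨L, R⟩
    simp only [growSet, Set.mem_image, Prod.exists, Set.mem_ofPred_eq, consR, Prod.mk.injEq, id]
    constructor
    · rintro (h | h | h)
      · exact Or.inl ⟨_, _, ‹_›, rfl, rfl⟩
      · exact Or.inr ⟨_, _, ‹_›, rfl, rfl⟩
    · rintro (⟨L, R, h, rfl, rfl⟩ | ⟨L, R, h, rfl, rfl⟩)
      · exact .widen h
      · exact .settle h
  · rintro ⟨L, R⟩ - ⟨L', R'⟩ h' h
    have := (Grow.shape h').2.1
    obtain ⟨-, rfl⟩ := Prod.mk.inj h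
    simp at this

theorem growCount_entered_false :
    growCount (entered false) d a p m =
      growCount widening (d + 1) a p m + growCount (entered false) (d + 1) a p m := by
  refine ncard_eq_add (consR_injective [S]) (consL_injective [E]) (growSet_finite ..)
    (growSet_finite ..) ?_ ?_
  · rintro ⟨L, R⟩
    simp only [growSet, Set.mem_image, Prod.exists, Set.mem_ofPred_eq, consR, consL, Prod.mk.injEq]
    constructor
    · rintro (h | h | h)
      · exact Or.inl ⟨_, _, ‹_›, rfl, rfl⟩
      · exact Or.inr ⟨_, _, ‹_›, rfl, rfl⟩
    · rintro (⟨L, R, h, rfl, rfl⟩ | ⟨L, R, h, rfl, rfl⟩)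
      · exact .enterWide h
      · exact .east h
  · rintro ⟨L, R⟩ h' ⟨L', R'⟩ - h
    have := (Grow.shape h').1
    simp_all [consR, consL]

theorem growCount_entered_true :
    growCount (entered true) d a p m =
      growCount shrinking d a p m + growCount (entered true) (d + 1) a p m := by
  refine ncard_eq_add (consR_injective [S]) (consL_injective [E]) (growSet_finite ..)
    (growSet_finite ..) ?_ ?_
  · rintro ⟨L, R⟩
    simp only [growSet, Set.mem_image, Prod.exists, Set.mem_ofPred_eq, consR, consL, Prod.mk.injEq]
    constructor
    · rintro (h | h | h)
      · exact Or.inl ⟨_, _, ‹_›, rfl, rfl⟩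
      · exact Or.inr ⟨_, _, ‹_›, rfl, rfl⟩
    · rintro (⟨L, R, h, rfl, rfl⟩ | ⟨L, R, h, rfl, rfl⟩)
      · exact .enterShrink h
      · exact .east h
  · rintro ⟨L, R⟩ h' ⟨L', R'⟩ - h
    have := (Grow.shape h').1
    simp_all [consR, consL]

theorem growCount_upper :
    growCount (upper b) d a p m =
      growCount (entered b) (d + 1) a p m + growCount (upper b) (d + 1) a p m := by
  refine ncard_eq_add (consL_injective [E, N]) (consL_injective [E]) (growSet_finite ..)
    (growSet_finite ..) ?_ ?_
  · rintro ⟨L, R⟩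
    simp only [growSet, Set.mem_image, Prod.exists, Set.mem_ofPred_eq, consL, Prod.mk.injEq]
    constructor
    · rintro (h | h | h)
      · exact Or.inl ⟨_, _, ‹_›, rfl, rfl⟩
      · exact Or.inr ⟨_, _, ‹_›, rfl, rfl⟩
    · rintro (⟨L, R, h, rfl, rfl⟩ | ⟨L, R, h, rfl, rfl⟩)
      · exact .indent h
      · exact .eastUpper h
  · rintro ⟨L, R⟩ - ⟨L', R'⟩ h' h
    have := (Grow.shape h').1
    simp only [consL, Prod.mk.injEq, List.cons_append, List.nil_append, List.cons.injEq] at h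
    simp [← h.1.2] at this

theorem growCount_lower :
    growCount (lower b) d a p m =
      growCount (upper b) (d + 1) a p m + growCount (lower b) (d + 1) a p m := by
  refine ncard_eq_add (consL_injective [E, S]) (consL_injective [E]) (growSet_finite ..)
    (growSet_finite ..) ?_ ?_
  · rintro ⟨L, R⟩
    simp only [growSet, Set.mem_image, Prod.exists, Set.mem_ofPred_eq, consL, Prod.mk.injEq]
    constructor
    · rintro (h | h | h)
      · exact Or.inl ⟨_, _, ‹_›, rfl, rfl⟩
      · exact Or.inr ⟨_, _, ‹_›, rfl, rfl⟩
    · rintro (⟨L, R, h, rfl, rfl⟩ | ⟨L, R, h, rfl, rfl⟩)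
      · exact .descend h
      · exact .eastLower h
  · rintro ⟨L, R⟩ - ⟨L', R'⟩ h' h
    have := (Grow.shape h').1
    simp only [consL, Prod.mk.injEq, List.cons_append, List.nil_append, List.cons.injEq] at h
    simp [← h.1.2] at this

theorem growCount_raised_zero_zero : growCount (raised b) d a 0 0 = 0 := by
  rw [growCount, show growSet (raised b) d a 0 0 = ∅ from ?_, Set.ncard_empty]
  ext ⟨L, R⟩
  simp only [growSet, Set.mem_ofPred_eq, Set.mem_empty_iff_false, iff_false]
  rintro ⟨⟩

theorem growCount_raised_succ_zero :
    growCount (raised b) d a (p + 1) 0 = growCount (entered b) d a p 0 := by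
  refine ncard_eq_of_image (consL_injective [N]) ?_
  rintro ⟨L, R⟩
  simp only [growSet, Set.mem_image, Prod.exists, Set.mem_ofPred_eq, consL, Prod.mk.injEq]
  constructor
  · rintro ⟨⟩
    exact ⟨_, _, ‹_›, rfl, rfl⟩
  · rintro ⟨L, R, h, rfl, rfl⟩
    exact .raise h

theorem growCount_raised_zero_succ :
    growCount (raised b) d a 0 (m + 1) = growCount (lower b) d a 0 m := by
  refine ncard_eq_of_image (consL_injective [N]) ?_
  rintro ⟨L, R⟩
  simp only [growSet, Set.mem_image, Prod.exists, Set.mem_ofPred_eq, consL, Prod.mk.injEq]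
  constructor
  · rintro ⟨⟩
    exact ⟨_, _, ‹_›, rfl, rfl⟩
  · rintro ⟨L, R, h, rfl, rfl⟩
    exact .raiseIndent h

/-- Both rules prepend `N`; the last step of the left edge before it that is not `E` is `N` for a
row crossed once and `S` for an indent. -/
theorem growCount_raised_succ_succ :
    growCount (raised b) d a (p + 1) (m + 1) =
      growCount (entered b) d a p (m + 1) + growCount (lower b) d a (p + 1) m := by
  refine ncard_eq_add (consL_injective [N]) (consL_injective [N]) (growSet_finite ..)
    (growSet_finite ..) ?_ ?_
  · rintro ⟨L, R⟩
    simp only [growSet, Set.mem_image, Prod.exists, Set.mem_ofPred_eq, consL, Prod.mk.injEq]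
    constructor
    · rintro (h | h | h)
      · exact Or.inl ⟨_, _, ‹_›, rfl, rfl⟩
      · exact Or.inr ⟨_, _, ‹_›, rfl, rfl⟩
    · rintro (⟨L, R, h, rfl, rfl⟩ | ⟨L, R, h, rfl, rfl⟩)
      · exact .raise h
      · exact .raiseIndent h
  · rintro ⟨L, R⟩ h1 ⟨L', R'⟩ h2 h
    have h1 := (Grow.shape h1).1
    have h2 := (Grow.shape h2).2.1
    simp_all [consL]

/-- `turn` and `shrink` both prepend `E`, and are told apart by whether the right boundary already
contains an `E`; after `keep` it starts with `S`. -/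
theorem growCount_shrinking :
    growCount shrinking d a p m = growCount shrinking (d + 1) a p m +
      growCount (raised false) (d + 1) a p m + growCount (raised true) d a p m := by
  have e : (growSet shrinking (d + 1) a p m ∪ growSet (raised false) (d + 1) a p m).ncard =
      growCount shrinking (d + 1) a p m + growCount (raised false) (d + 1) a p m := by
    refine Set.ncard_union_eq ?_ (growSet_finite ..) (growSet_finite ..)
    rw [Set.disjoint_left]
    intro q h1 h2
    have h1 := (Grow.shape h1).2
    have h2 := (Grow.shape h2).2.2
    simp_all
  rw [← e]
  refine ncard_eq_add (consR_injective [E]) Function.injective_id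
    ((growSet_finite ..).union (growSet_finite ..)) (growSet_finite ..) ?_ ?_
  · rintro ⟨L, R⟩
    simp only [growSet, Set.mem_image, Prod.exists, Set.mem_ofPred_eq, consR, Prod.mk.injEq, id,
      Set.mem_union]
    constructor
    · rintro (h | h | h)
      · exact Or.inl ⟨_, _, Or.inr ‹_›, rfl, rfl⟩
      · exact Or.inl ⟨_, _, Or.inl ‹_›, rfl, rfl⟩
      · exact Or.inr ⟨_, _, ‹_›, rfl, rfl⟩
    · rintro (⟨L, R, h | h, rfl, rfl⟩ | ⟨L, R, h, rfl, rfl⟩)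
      · exact .shrink h
      · exact .turn h
      · exact .keep h
  · rintro ⟨L, R⟩ - ⟨L', R'⟩ h' h
    have := (Grow.shape h').2.1
    obtain ⟨-, rfl⟩ := Prod.mk.inj h
    simp at this

end Recursions

/-! ### From counts to power series -/

/-- The generating function of the pairs of walks in a given stage: `x` marks the width, `y` the
rows above the first that are crossed once by the left edge, and the outer variable those crossed
three times. -/
noncomputable def growSeries (s : Stage) (d : ℕ) : PowerSeries Series :=
  PowerSeries.mk fun m => fun e => (growCount s d (e 0) (e 1) m : ℚ)

theorem coeff_growSeries (s : Stage) (d m : ℕ) (e : Fin 2 →₀ ℕ) :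
    MvPowerSeries.coeff e (coeff m (growSeries s d)) = growCount s d (e 0) (e 1) m := by
  exact congrArg (MvPowerSeries.coeff e) (coeff_mk m _)

theorem coeff_X_mul_eq (i : Fin 2) (f : Series) (e : Fin 2 →₀ ℕ) :
    MvPowerSeries.coeff e (MvPowerSeries.X i * f) =
      if e i = 0 then 0 else MvPowerSeries.coeff (e - Finsupp.single i 1) f := by
  classical
  rw [MvPowerSeries.X, MvPowerSeries.coeff_monomial_mul, one_mul]
  by_cases h : e i = 0
  · rw [if_neg, if_pos h]
    simp [h]
  · rw [if_pos, if_neg h]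
    rw [Finsupp.single_le_iff]
    omega

theorem growSeries_hasOrderGE (s : Stage) (d : ℕ) : HasOrderGE d (growSeries s d) := by
  intro m e he
  rw [coeff_growSeries, growCount, show growSet s d (e 0) (e 1) m = ∅ from ?_]
  · simp
  · ext ⟨L, R⟩
    simp only [growSet, Set.mem_ofPred_eq, Set.mem_empty_iff_false, iff_false]
    intro h
    have := h.le_width
    omega

theorem growSeries_widening_zero : growSeries widening 0 = 1 := by
  ext m e
  rw [coeff_growSeries, growCount_widening_zero, coeff_one]
  by_cases hm : m = 0
  · subst hm
    have : (e 0 = 0 ∧ e 1 = 0 ∧ (0 : ℕ) = 0) ↔ e = 0 := by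
      constructor
      · rintro ⟨h0, h1, -⟩
        ext i
        fin_cases i <;> assumption
      · rintro rfl
        simp
    classical
    rw [if_pos rfl, MvPowerSeries.coeff_one, if_congr this rfl rfl]
    split_ifs <;> simp
  · simp [hm]

theorem growSeries_widening_succ (d : ℕ) :
    growSeries widening (d + 1) = C x * growSeries widening d + growSeries (raised false) d := by
  ext m e
  rw [map_add, map_add, coeff_C_mul, x, coeff_X_mul_eq]
  simp only [coeff_growSeries]
  split_ifs with h
  · rw [h, growCount_widening_succ_zero, zero_add]
  · obtain ⟨k, hk⟩ := Nat.exists_eq_succ_of_ne_zero h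
    simp only [Finsupp.coe_tsub, Pi.sub_apply, Finsupp.single_eq_same]
    rw [hk, Nat.succ_eq_add_one, growCount_widening_succ_succ]
    simp

theorem growSeries_raised (b : Bool) (d : ℕ) : growSeries (raised b) d =
    C y * growSeries (entered b) d + X * growSeries (lower b) d := by
  ext m e
  rw [map_add, map_add, coeff_C_mul, y, coeff_X_mul_eq]
  have e0 : (e - Finsupp.single 1 1 : Fin 2 →₀ ℕ) 0 = e 0 := by simp
  have e1 : (e - Finsupp.single 1 1 : Fin 2 →₀ ℕ) 1 = e 1 - 1 := by simp
  cases m with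
  | zero =>
    simp only [coeff_growSeries, coeff_zero_X_mul, map_zero, add_zero, e0, e1]
    split_ifs with h
    · rw [h, growCount_raised_zero_zero, Nat.cast_zero]
    · obtain ⟨k, hk⟩ := Nat.exists_eq_succ_of_ne_zero h
      rw [hk, Nat.succ_eq_add_one, growCount_raised_succ_zero, Nat.add_sub_cancel]
  | succ m =>
    simp only [coeff_growSeries, coeff_succ_X_mul, e0, e1]
    split_ifs with h
    · rw [h, growCount_raised_zero_succ, zero_add]
    · obtain ⟨k, hk⟩ := Nat.exists_eq_succ_of_ne_zero h
      rw [hk, Nat.succ_eq_add_one, growCount_raised_succ_succ, Nat.add_sub_cancel, Nat.cast_add]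

theorem growSeries_entered_false (d : ℕ) : growSeries (entered false) d =
    growSeries widening (d + 1) + growSeries (entered false) (d + 1) := by
  ext m e
  rw [map_add, map_add]
  simp only [coeff_growSeries]
  rw [growCount_entered_false, Nat.cast_add]

theorem growSeries_entered_true (d : ℕ) : growSeries (entered true) d =
    growSeries shrinking d + growSeries (entered true) (d + 1) := by
  ext m e
  rw [map_add, map_add]
  simp only [coeff_growSeries]
  rw [growCount_entered_true, Nat.cast_add]

theorem growSeries_upper (b : Bool) (d : ℕ) : growSeries (upper b) d =
    growSeries (entered b) (d + 1) + growSeries (upper b) (d + 1) := by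
  ext m e
  rw [map_add, map_add]
  simp only [coeff_growSeries]
  rw [growCount_upper, Nat.cast_add]

theorem growSeries_lower (b : Bool) (d : ℕ) : growSeries (lower b) d =
    growSeries (upper b) (d + 1) + growSeries (lower b) (d + 1) := by
  ext m e
  rw [map_add, map_add]
  simp only [coeff_growSeries]
  rw [growCount_lower, Nat.cast_add]

theorem growSeries_shrinking (d : ℕ) : growSeries shrinking d =
    growSeries shrinking (d + 1) + growSeries (raised false) (d + 1) +
      growSeries (raised true) d := by
  ext m e
  simp only [map_add, coeff_growSeries]
  rw [growCount_shrinking, Nat.cast_add, Nat.cast_add]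

theorem rowSystem_false : RowSystem (growSeries (entered false)) (growSeries (upper false))
    (growSeries (lower false)) (growSeries (raised false)) (growSeries widening) where
  u_eq := growSeries_entered_false
  v_eq := growSeries_upper false
  w_eq := growSeries_lower false
  h_eq := growSeries_raised false
  u_low := growSeries_hasOrderGE _
  v_low := growSeries_hasOrderGE _
  w_low := growSeries_hasOrderGE _

/-- The index `d - 1` compensates the offset: at the same parameter the gap is one larger in stage
`shrinking` than in `widening`. The truncated value at `d = 0` plays no role, as a `RowSystem` only
looks at `g (d + 1)`. -/
theorem rowSystem_true : RowSystem (growSeries (entered true)) (growSeries (upper true))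
    (growSeries (lower true)) (growSeries (raised true))
    (fun d => growSeries shrinking (d - 1)) where
  u_eq := growSeries_entered_true
  v_eq := growSeries_upper true
  w_eq := growSeries_lower true
  h_eq := growSeries_raised true
  u_low := growSeries_hasOrderGE _
  v_low := growSeries_hasOrderGE _
  w_low := growSeries_hasOrderGE _

theorem growSeries_staircase_equation :
    growSeries (entered false) 0 * (1 - C x - risingSeries (growSeries (entered false) 0) -
      risingSeries (growSeries (entered false) 0) * growSeries (entered false) 0) = C x :=
  (staircase_equation rowSystem_false growSeries_widening_zero growSeries_widening_succ).2.2

theorem growSeries_unimodal_equation :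
    (growSeries (entered false) 0 + growSeries (entered true) 0) *
      (1 - C x - risingSeries (growSeries (entered false) 0) -
      2 * risingSeries (growSeries (entered false) 0) * growSeries (entered false) 0) = C x :=
  unimodal_equation rowSystem_false growSeries_widening_zero growSeries_widening_succ
    rowSystem_true growSeries_shrinking (growSeries_hasOrderGE _)

theorem coeff_growSeries_staircase (m : ℕ) :
    coeff (m + 1) (growSeries (entered false) 0) =
      MvPowerSeries.C (1 / ((m + 1).factorial : ℚ)) *
        dy^[m] (I ^ (m + 1) * dy (divY SP)) :=
  coeff_eq_of_burgers growSeries_staircase_equation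
    (burgers_staircase growSeries_staircase_equation)
    (constantCoeff_eq_divY_SP growSeries_staircase_equation) m

theorem coeff_growSeries_unimodal (m : ℕ) :
    coeff (m + 1) (growSeries (entered false) 0 + growSeries (entered true) 0) =
      MvPowerSeries.C (1 / ((m + 1).factorial : ℚ)) *
        dy^[m] (I ^ (m + 1) * dy (divY UP)) :=
  coeff_eq_of_burgers growSeries_staircase_equation
    (burgers_unimodal growSeries_staircase_equation growSeries_unimodal_equation)
    (constantCoeff_eq_divY_UP growSeries_staircase_equation growSeries_unimodal_equation) m

end MConvex

namespace MConvex

open Step Stage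

/-! ### Displacements -/

/-- The horizontal displacement of a walk. -/
def xdisp (w : List Step) : ℤ := (w.map fun s => s.vec.1).sum

/-- The vertical displacement of a walk. -/
def ydisp (w : List Step) : ℤ := (w.map fun s => s.vec.2).sum

section Displacement

variable (u v w : List Step)

@[simp] theorem xdisp_nil : xdisp [] = 0 := rfl

@[simp] theorem ydisp_nil : ydisp [] = 0 := rfl

@[simp] theorem xdisp_append : xdisp (u ++ v) = xdisp u + xdisp v := by simp [xdisp]

@[simp] theorem ydisp_append : ydisp (u ++ v) = ydisp u + ydisp v := by simp [ydisp]

@[simp] theorem xdisp_reverse : xdisp w.reverse = xdisp w := by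
  simp [xdisp, List.map_reverse, List.sum_reverse]

@[simp] theorem ydisp_reverse : ydisp w.reverse = ydisp w := by
  simp [ydisp, List.map_reverse, List.sum_reverse]

@[simp] theorem xdisp_N : xdisp (N :: w) = xdisp w := by simp [xdisp, Step.vec]

@[simp] theorem xdisp_S : xdisp (S :: w) = xdisp w := by simp [xdisp, Step.vec]

@[simp] theorem xdisp_E : xdisp (E :: w) = xdisp w + 1 := by simp [xdisp, Step.vec, add_comm]

@[simp] theorem xdisp_W : xdisp (W :: w) = xdisp w - 1 := by
  simp only [xdisp, Step.vec, List.map_cons, List.sum_cons]; ring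

@[simp] theorem ydisp_N : ydisp (N :: w) = ydisp w + 1 := by simp [ydisp, Step.vec, add_comm]

@[simp] theorem ydisp_S : ydisp (S :: w) = ydisp w - 1 := by
  simp only [ydisp, Step.vec, List.map_cons, List.sum_cons]; ring

@[simp] theorem ydisp_E : ydisp (E :: w) = ydisp w := by simp [ydisp, Step.vec]

@[simp] theorem ydisp_W : ydisp (W :: w) = ydisp w := by simp [ydisp, Step.vec]

theorem pos_eq (k : ℕ) : pos w k = (xdisp (w.take k), ydisp (w.take k)) := by
  rw [pos]
  induction w.take k with
  | nil => rfl
  | cons s l ih => rw [List.map_cons, List.sum_cons, ih]; rfl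

theorem pos_append_length : pos (u ++ v) u.length = (xdisp u, ydisp u) := by
  rw [pos_eq, List.take_left]

end Displacement

/-! ### The walks of the construction -/

/-- The excess of the height of the end of the left edge over the number of rows. -/
def Stage.isUpper : Stage → ℕ
  | upper _ => 1
  | _ => 0

/-- Whether the right boundary has entered the last row. -/
def Stage.isOpen : Stage → ℕ
  | entered _ | upper _ | lower _ => 1
  | _ => 0

/-- The number of additional vertical steps of the left edge, inside an indent. -/
def Stage.extra : Stage → ℕ
  | upper _ => 1
  | lower _ => 2
  | _ => 0

/-- Whether the left edge is inside an indent. -/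
def Stage.isIndent : Stage → ℕ
  | upper _ | lower _ => 1
  | _ => 0

/-- Whether the right boundary has moved to the left. -/
def Stage.turned : Stage → Bool
  | widening => false
  | shrinking => true
  | entered c | upper c | lower c | raised c => c

/-- The positions of the ends of the two walks, and the numbers of their steps. -/
structure Grow.Coords (s : Stage) (d a p m : ℕ) (L R : List Step) : Prop where
  gap : -xdisp R = xdisp L + d + s.offset
  heightL : ydisp L = p + m + 1 + s.isUpper
  heightR : -ydisp R = p + m + s.isOpen
  lengthL : (L.length : ℤ) = xdisp L + p + 3 * m + 1 + s.extra
  lengthR : (R.length : ℤ) = 2 * a + xdisp R - ydisp R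
  eastL : (L.count E : ℤ) = xdisp L
  eastR : (R.count E : ℤ) = a + xdisp R
  wide : s.turned = false → -xdisp R = a
  noN : N ∉ R
  noW : W ∉ L
  bottom : ∃ L', L = L' ++ [N]
  far : ∃ r, r <:+ R ∧ -xdisp r = a

theorem Grow.coords {s d a p m L R} (h : Grow s d a p m L R) : Grow.Coords s d a p m L R := by
  induction h with
  | base => constructor <;> simp [Stage.offset, Stage.isUpper, Stage.isOpen, Stage.extra]
  | widen _ ih =>
    obtain ⟨h1, h2, h3, h4, h5, h6, h7, h8, h9, h10, ⟨L', rfl⟩, -⟩ := ih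
    refine ⟨?_, ?_, ?_, ?_, ?_, ?_, ?_, ?_, ?_, h10, ⟨L', rfl⟩, _, List.suffix_rfl, ?_⟩ <;>
      simp [Stage.offset, Stage.isUpper, Stage.isOpen, Stage.extra, Stage.turned] at * <;>
      omega
  | enterWide _ ih | enterShrink _ ih | shrink _ ih =>
    obtain ⟨h1, h2, h3, h4, h5, h6, h7, h8, h9, h10, ⟨L', rfl⟩, r, hr, hr'⟩ := ih
    refine ⟨?_, ?_, ?_, ?_, ?_, ?_, ?_, ?_, ?_, h10, ⟨L', rfl⟩, r,
      hr.trans (List.suffix_cons _ _), hr'⟩ <;>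
      simp [Stage.offset, Stage.isUpper, Stage.isOpen, Stage.extra, Stage.turned] at * <;>
      omega
  | turn _ ih =>
    obtain ⟨h1, h2, h3, h4, h5, h6, h7, h8, h9, h10, ⟨L', rfl⟩, r, hr, hr'⟩ := ih
    refine ⟨?_, ?_, ?_, ?_, ?_, ?_, ?_, ?_, ?_, h10, ⟨L', rfl⟩, r,
      hr.trans (List.suffix_cons _ _), hr'⟩ <;>
      simp [Stage.offset, Stage.isUpper, Stage.isOpen, Stage.extra, Stage.turned] at * <;>
      omega
  | settle _ ih | keep _ ih =>
    obtain ⟨h1, h2, h3, h4, h5, h6, h7, h8, h9, h10, ⟨L', rfl⟩, r, hr, hr'⟩ := ih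
    refine ⟨?_, ?_, ?_, ?_, ?_, ?_, ?_, ?_, ?_, h10, ⟨L', rfl⟩, r, hr, hr'⟩ <;>
      simp [Stage.offset, Stage.isUpper, Stage.isOpen, Stage.extra, Stage.turned] at * <;>
      omega
  | indent _ ih | descend _ ih =>
    obtain ⟨h1, h2, h3, h4, h5, h6, h7, h8, h9, h10, ⟨L', rfl⟩, r, hr, hr'⟩ := ih
    refine ⟨?_, ?_, ?_, ?_, ?_, ?_, ?_, ?_, h9, ?_, ⟨_ :: _ :: L', rfl⟩, r, hr, hr'⟩ <;>
      simp [Stage.offset, Stage.isUpper, Stage.isOpen, Stage.extra, Stage.turned] at * <;>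
      omega
  | east _ ih | eastUpper _ ih | eastLower _ ih | raise _ ih | raiseIndent _ ih =>
    obtain ⟨h1, h2, h3, h4, h5, h6, h7, h8, h9, h10, ⟨L', rfl⟩, r, hr, hr'⟩ := ih
    refine ⟨?_, ?_, ?_, ?_, ?_, ?_, ?_, ?_, h9, ?_, ⟨_ :: L', rfl⟩, r, hr, hr'⟩ <;>
      simp [Stage.offset, Stage.isUpper, Stage.isOpen, Stage.extra, Stage.turned] at * <;>
      omega

/-! ### Self-avoidance of the two walks -/

/-- The left edge `L` (reversed, starting at the origin) and the right boundary `R` (ending at the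
origin) are self-avoiding, disjoint, and lie in a box of width `a`, below height `T`. -/
structure Disjointness (L R : List Step) (a T : ℤ) : Prop where
  left : ∀ l, l <:+ L → 0 ≤ xdisp l ∧ xdisp l ≤ xdisp L ∧ 0 ≤ ydisp l ∧ ydisp l ≤ T
  right : ∀ r, r <:+ R → 0 ≤ -xdisp r ∧ -xdisp r ≤ a ∧ 0 ≤ -ydisp r ∧ -ydisp r ≤ -ydisp R
  simpleL : ∀ l v, v ++ l <:+ L → v ≠ [] → xdisp v = 0 → ydisp v ≠ 0
  simpleR : ∀ r v, v ++ r <:+ R → v ≠ [] → xdisp v = 0 → ydisp v ≠ 0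
  disjoint : ∀ l r, l <:+ L → r <:+ R → xdisp l = -xdisp r → ydisp l = -ydisp r → l = [] ∧ r = []

theorem simple_cons {s : Step} {L : List Step}
    (h : ∀ l v, v ++ l <:+ L → v ≠ [] → xdisp v = 0 → ydisp v ≠ 0)
    (hs : ∀ l, l <:+ L → xdisp l = xdisp (s :: L) → ydisp l ≠ ydisp (s :: L)) :
    ∀ l v, v ++ l <:+ s :: L → v ≠ [] → xdisp v = 0 → ydisp v ≠ 0 := by
  intro l v hl hv h1 h2
  rcases List.suffix_cons_iff.1 hl with hl | hl
  · obtain ⟨c, v, rfl⟩ := List.exists_cons_of_ne_nil hv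
    refine hs l ⟨v, (List.cons.inj hl).2⟩ ?_ ?_
    · rw [← hl, xdisp_append, h1, zero_add]
    · rw [← hl, ydisp_append, h2, zero_add]
  · exact h l v hl hv h1 h2

namespace Disjointness

variable {L R : List Step} {a T : ℤ}

theorem consL (h : Disjointness L R a T) (s : Step) {T' : ℤ} (hT : T ≤ T')
    (hx : xdisp L ≤ xdisp (s :: L)) (hy : 0 ≤ ydisp (s :: L) ∧ ydisp (s :: L) ≤ T')
    (hl : ∀ l, l <:+ L → xdisp l = xdisp (s :: L) → ydisp l ≠ ydisp (s :: L))
    (hr : ∀ r, r <:+ R → xdisp (s :: L) = -xdisp r → ydisp (s :: L) ≠ -ydisp r) :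
    Disjointness (s :: L) R a T' where
  left l hl := by
    rcases List.suffix_cons_iff.1 hl with rfl | hl
    · have := h.left L List.suffix_rfl
      omega
    · have := h.left l hl
      omega
  right := h.right
  simpleL := simple_cons h.simpleL hl
  simpleR := h.simpleR
  disjoint l r hl' hr' h1 h2 := by
    rcases List.suffix_cons_iff.1 hl' with rfl | hl'
    · exact absurd h2 (hr r hr' h1)
    · exact h.disjoint l r hl' hr' h1 h2

theorem consR (h : Disjointness L R a T) (s : Step) {a' : ℤ} (ha : a ≤ a')
    (hx : 0 ≤ -xdisp (s :: R) ∧ -xdisp (s :: R) ≤ a') (hy : -ydisp R ≤ -ydisp (s :: R))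
    (hr : ∀ r, r <:+ R → xdisp r = xdisp (s :: R) → ydisp r ≠ ydisp (s :: R))
    (hl : ∀ l, l <:+ L → xdisp l = -xdisp (s :: R) → ydisp l ≠ -ydisp (s :: R)) :
    Disjointness L (s :: R) a' T where
  left := h.left
  right r hr := by
    rcases List.suffix_cons_iff.1 hr with rfl | hr
    · have := h.right R List.suffix_rfl
      omega
    · have := h.right r hr
      omega
  simpleL := h.simpleL
  simpleR := simple_cons h.simpleR hr
  disjoint l r hl' hr' h1 h2 := by
    rcases List.suffix_cons_iff.1 hr' with rfl | hr'
    · exact absurd h2 (hl l hl' h1)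
    · exact h.disjoint l r hl' hr' h1 h2

end Disjointness

/-- The two walks are self-avoiding and disjoint, with the additional facts on the extremal vertices
that are needed to extend them. -/
structure Grow.Geometry (s : Stage) (a p m : ℕ) (L R : List Step) : Prop where
  disj : Disjointness L R a (p + m + 1 + s.isIndent)
  fresh : s.isIndent = 1 → ∀ l, l <:+ L → xdisp l = xdisp L → l = L
  start : s ≠ widening → s ≠ shrinking → ∀ r, r <:+ R → ydisp r = ydisp R → r = R
  shrunk : s = shrinking → ∀ r, r <:+ R → ydisp r = ydisp R → xdisp r ≤ xdisp R

theorem fresh_consE {L : List Step} (h : ∀ l, l <:+ L → xdisp l ≤ xdisp L) :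
    ∀ l, l <:+ E :: L → xdisp l = xdisp (E :: L) → l = E :: L := by
  intro l hl h1
  rcases List.suffix_cons_iff.1 hl with rfl | hl
  · rfl
  · have := h l hl
    rw [xdisp_E] at h1
    omega

theorem Disjointness.consE {L R : List Step} {a T : ℤ} (h : Disjointness L R a T)
    (hR : ∀ r, r <:+ R → xdisp L + 1 = -xdisp r → ydisp L ≠ -ydisp r) :
    Disjointness (E :: L) R a T := by
  have h0 := h.left L List.suffix_rfl
  refine h.consL E le_rfl (by simp) (by simpa using h0.2.2) (fun l hl h1 => ?_) ?_
  · have := h.left l hl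
    rw [xdisp_E] at h1
    omega
  · simpa using hR

/-- Every new vertex is beyond its own walk in some direction, or in a row or column where the
extremal clauses control the earlier vertices; the positive gap keeps it off the other walk. -/
theorem Grow.geometry {s d a p m L R} (h : Grow s d a p m L R) : Grow.Geometry s a p m L R := by
  induction h with
  | base =>
    refine ⟨⟨?_, ?_, ?_, ?_, ?_⟩, ?_, ?_, ?_⟩
    · intro l hl
      rcases List.suffix_cons_iff.1 hl with rfl | hl
      · simp
      · rw [List.suffix_nil.1 hl]
        simp [Stage.isIndent]
    · intro r hr
      simp [List.suffix_nil.1 hr]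
    · refine simple_cons ?_ ?_
      · intro l v hv h
        exact absurd (List.append_eq_nil_iff.1 (List.suffix_nil.1 hv)).1 h
      · intro l hl
        simp [List.suffix_nil.1 hl]
    · intro l v hv h
      exact absurd (List.append_eq_nil_iff.1 (List.suffix_nil.1 hv)).1 h
    · intro l r hl hr
      rw [List.suffix_nil.1 hr]
      rcases List.suffix_cons_iff.1 hl with rfl | hl
      · simp
      · simp [List.suffix_nil.1 hl]
    all_goals simp [Stage.isIndent]
  | widen h ih =>
    have c := h.coords
    have g := c.gap
    -- Before the turn the right boundary stands at the maximal abscissa `a`, so a further widening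
    -- step reaches a new column.
    have w := c.wide rfl
    obtain ⟨h1, h2, h3, h4⟩ := ih
    have b := h1.right _ List.suffix_rfl
    refine ⟨h1.consR W (by simp) (by simp; omega) (by simp) (fun r hr => ?_) (fun l hl => ?_),
      by simp [Stage.isIndent], by simp, by simp⟩
    · have := h1.right r hr
      simp; omega
    · have := h1.left l hl
      simp [Stage.offset] at g ⊢; omega
  | settle h ih =>
    obtain ⟨h1, h2, h3, h4⟩ := ih
    exact ⟨h1, by simp [Stage.isIndent], by simp, by simp⟩
  | keep h ih =>
    obtain ⟨h1, h2, h3, h4⟩ := ih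
    refine ⟨h1, by simp [Stage.isIndent], by simp, fun _ r hr hy => ?_⟩
    rw [h3 (by simp) (by simp) r hr hy]
  | enterWide h ih | enterShrink h ih =>
    have c := h.coords
    have g := c.gap
    obtain ⟨h1, h2, h3, h4⟩ := ih
    have b := h1.right _ List.suffix_rfl
    refine ⟨h1.consR S le_rfl (by simp; omega) (by simp) (fun r hr => ?_) (fun l hl => ?_),
      by simp [Stage.isIndent], fun _ _ r hr hy => ?_, by simp⟩
    · have := h1.right r hr
      simp; omega
    · have := h1.left l hl
      simp [Stage.offset] at g ⊢; omega
    · rcases List.suffix_cons_iff.1 hr with rfl | hr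
      · rfl
      · have := h1.right r hr
        simp at hy; omega
  | east h ih =>
    have c := h.coords
    have g := c.gap
    obtain ⟨h1, h2, h3, h4⟩ := ih
    refine ⟨h1.consE fun r hr hx hy => ?_, by simp [Stage.isIndent],
      fun _ _ => h3 (by simp) (by simp), by simp⟩
    have hL := c.heightL
    have hR := c.heightR
    simp [Stage.isUpper, Stage.isOpen, Stage.offset] at hL hR g
    obtain rfl := h3 (by simp) (by simp) r hr (by omega)
    omega
  | eastUpper h ih | eastLower h ih =>
    have c := h.coords
    have g := c.gap
    obtain ⟨h1, h2, h3, h4⟩ := ih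
    refine ⟨h1.consE fun r hr hx hy => ?_, fun _ => fresh_consE fun l hl => (h1.left l hl).2.1,
      fun _ _ => h3 (by simp) (by simp), by simp⟩
    have hL := c.heightL
    have hR := c.heightR
    simp [Stage.isUpper, Stage.isOpen, Stage.offset] at hL hR g
    have := h1.right r hr
    obtain rfl := h3 (by simp) (by simp) r hr (by omega)
    omega
  | @indent b d a p m L R h ih =>
    have c := h.coords
    have g := c.gap
    have hL := c.heightL
    have hR := c.heightR
    obtain ⟨h1, h2, h3, h4⟩ := ih
    simp [Stage.isUpper, Stage.isOpen, Stage.offset] at hL hR g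
    have k := h1.consL N (T' := p + m + 1 + (upper b).isIndent) (by simp [Stage.isIndent])
      (by simp) (by simp [Stage.isIndent]; omega)
      (fun l hl => by
        have := h1.left l hl
        simp [Stage.isIndent] at this ⊢; omega)
      (fun r hr => by
        have := h1.right r hr
        simp; omega)
    refine ⟨(k.consE fun r hr => ?_), fun _ => fresh_consE fun l hl => (k.left l hl).2.1,
      fun _ _ => h3 (by simp) (by simp), by simp⟩
    have := h1.right r hr
    simp; omega
  | descend h ih =>
    have c := h.coords
    have g := c.gap
    have hL := c.heightL
    have hR := c.heightR
    obtain ⟨h1, h2, h3, h4⟩ := ih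
    simp [Stage.isUpper, Stage.isOpen, Stage.offset] at hL hR g
    -- Inside an indent the end of `L` is alone in its column, so a vertical step cannot hit the
    -- left edge.
    have k := h1.consL S le_rfl (by simp)
      (by simp [Stage.isIndent]; omega)
      (fun l hl hx => by
        rw [h2 rfl l hl (by simpa using hx)]
        simp
        omega)
      (fun r hr hx hy => by
        simp at hx hy
        obtain rfl := h3 (by simp) (by simp) r hr (by omega)
        omega)
    refine ⟨(k.consE fun r hr hx hy => ?_), fun _ => fresh_consE fun l hl => (k.left l hl).2.1,
      fun _ _ => h3 (by simp) (by simp), by simp⟩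
    simp at hx hy
    obtain rfl := h3 (by simp) (by simp) r hr (by omega)
    omega
  | raise h ih =>
    have c := h.coords
    have g := c.gap
    have hL := c.heightL
    have hR := c.heightR
    obtain ⟨h1, h2, h3, h4⟩ := ih
    simp [Stage.isUpper, Stage.isOpen, Stage.offset] at hL hR g
    refine ⟨h1.consL N (by simp [Stage.isIndent]) (by simp)
      (by simp [Stage.isIndent]; omega)
      (fun l hl => by
        have := h1.left l hl
        simp [Stage.isIndent] at this ⊢; omega)
      (fun r hr => by
        have := h1.right r hr
        simp; omega), by simp [Stage.isIndent], fun _ _ => h3 (by simp) (by simp), by simp⟩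
  | raiseIndent h ih =>
    have c := h.coords
    have g := c.gap
    have hL := c.heightL
    have hR := c.heightR
    obtain ⟨h1, h2, h3, h4⟩ := ih
    simp [Stage.isUpper, Stage.isOpen, Stage.offset] at hL hR g
    refine ⟨h1.consL N (by simp [Stage.isIndent]) (by simp)
      (by simp [Stage.isIndent]; omega)
      (fun l hl hx => by
        rw [h2 rfl l hl (by simpa using hx)]
        simp)
      (fun r hr => by
        have := h1.right r hr
        simp; omega), by simp [Stage.isIndent], fun _ _ => h3 (by simp) (by simp), by simp⟩
  | turn h ih =>
    have c := h.coords
    have g := c.gap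
    obtain ⟨h1, h2, h3, h4⟩ := ih
    have b := h1.right _ List.suffix_rfl
    have b' := h1.left _ List.suffix_rfl
    simp [Stage.offset] at g
    refine ⟨h1.consR E le_rfl (by simp; omega) (by simp) (fun r hr hx hy => ?_)
      (fun l hl => ?_), by simp [Stage.isIndent], by simp, fun _ r hr hy => ?_⟩
    · rw [h3 (by simp) (by simp) r hr (by simpa using hy)] at hx
      simp at hx
    · have := h1.left l hl
      simp; omega
    · rcases List.suffix_cons_iff.1 hr with rfl | hr
      · rfl
      · rw [h3 (by simp) (by simp) r hr (by simpa using hy)]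
        simp
  | shrink h ih =>
    have c := h.coords
    have g := c.gap
    obtain ⟨h1, h2, h3, h4⟩ := ih
    have b := h1.right _ List.suffix_rfl
    have b' := h1.left _ List.suffix_rfl
    simp [Stage.offset] at g
    refine ⟨h1.consR E le_rfl (by simp; omega) (by simp) (fun r hr hx hy => ?_)
      (fun l hl => ?_), by simp [Stage.isIndent], by simp, fun _ r hr hy => ?_⟩
    · have := h4 rfl r hr (by simpa using hy)
      simp at hx
      omega
    · have := h1.left l hl
      simp; omega
    · rcases List.suffix_cons_iff.1 hr with rfl | hr
      · rfl
      · have := h4 rfl r hr (by simpa using hy)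
        simp; omega

/-! ### Separation and heights of the indents -/

/-- The indents of the left edge are separated by rises, and at increasing heights. -/
structure Grow.Indents (s : Stage) (p m : ℕ) (L : List Step) : Prop where
  pair : ∀ v l, S :: (v ++ S :: l) <:+ L → ydisp l < ydisp (v ++ S :: l) ∧ N ∈ v
  bound : ∀ l, S :: l <:+ L → ydisp l ≤ p + m + 1 + (s.extra / 2 : ℕ)
  sep : s.extra ≠ 2 → ∀ v l, L = v ++ S :: l → N ∈ v

/-- A row has at most one step down, which starts at the top of that row; all earlier ones start
lower, and the rise that ends an indent separates it from the next. -/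
theorem Grow.indents {s d a p m L R} (h : Grow s d a p m L R) : Grow.Indents s p m L := by
  induction h with
  | base =>
    refine ⟨?_, ?_, ?_⟩
    · intro v l h
      simpa using List.suffix_cons_iff.1 h
    · intro l h
      simpa using List.suffix_cons_iff.1 h
    · intro _ v l h
      cases v with
      | nil => simp at h
      | cons c v => simp at h
  | widen _ ih | settle _ ih | enterWide _ ih | enterShrink _ ih | turn _ ih | shrink _ ih
  | keep _ ih => exact ⟨ih.pair, ih.bound, ih.sep⟩
  | raise _ ih | raiseIndent _ ih =>
    refine ⟨fun v l h => ?_, fun l h => ?_, fun _ v l h => ?_⟩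
    · exact ih.pair v l (by simpa [List.suffix_cons_iff] using h)
    · have := ih.bound l (by simpa [List.suffix_cons_iff] using h)
      simp [Stage.extra] at this ⊢; omega
    · cases v with
      | nil => simp at h
      | cons c v => simp at h; simp [h.1]
  | east _ ih | eastUpper _ ih | eastLower _ ih =>
    refine ⟨fun v l h => ?_, fun l h => ?_, fun hs v l h => ?_⟩
    · exact ih.pair v l (by simpa [List.suffix_cons_iff] using h)
    · exact ih.bound l (by simpa [List.suffix_cons_iff] using h)
    · cases v with
      | nil => simp at h
      | cons c v => simp at h; simp [ih.sep hs v l h.2]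
  | indent _ ih =>
    refine ⟨fun v l h => ?_, fun l h => ?_, fun hs v l h => ?_⟩
    · exact ih.pair v l (by simpa [List.suffix_cons_iff] using h)
    · simpa [Stage.extra] using ih.bound l (by simpa [List.suffix_cons_iff] using h)
    · rcases v with _ | ⟨c, _ | ⟨c', v⟩⟩
      · simp at h
      · simp at h
      · simp at h; simp [h.2.1]
  | @descend b d a p m L R h0 ih =>
    have hL := h0.coords.heightL
    simp [Stage.isUpper] at hL
    have hb := ih.bound
    simp [Stage.extra] at hb
    refine ⟨fun v l h => ?_, fun l h => ?_, by simp [Stage.extra]⟩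
    · have h : v ++ S :: l = L ∨ S :: (v ++ S :: l) <:+ L := by
        simpa [List.suffix_cons_iff] using h
      rcases h with h | h
      · refine ⟨?_, ih.sep (by simp [Stage.extra]) v l h.symm⟩
        have := hb l ⟨v, h⟩
        rw [h]
        omega
      · exact ih.pair v l h
    · have h : l = L ∨ S :: l <:+ L := by
        simpa [List.suffix_cons_iff] using h
      rcases h with rfl | h
      · simp [Stage.extra]; omega
      · have := hb l h
        simp [Stage.extra]; omega

end MConvex

namespace MConvex

open Step Stage

/-! ### The polygon of a complete construction -/

theorem exists_of_reverse_getElem? {L : List Step} {i : ℕ} {s : Step}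
    (h : L.reverse[i]? = some s) : ∃ v l, L = v ++ s :: l ∧ l.length = i := by
  obtain ⟨hi, rfl⟩ := List.getElem?_eq_some_iff.1 h
  refine ⟨(L.reverse.drop (i + 1)).reverse, (L.reverse.take i).reverse, ?_, ?_⟩
  · have := congrArg List.reverse (List.take_append_drop i L.reverse)
    rw [List.drop_eq_getElem_cons hi, List.reverse_reverse, List.reverse_append,
      List.reverse_cons] at this
    simpa using this.symm
  · simp at hi ⊢
    omega

theorem reverse_getElem?_length (v l : List Step) (s : Step) :
    (v ++ s :: l).reverse[l.length]? = some s := by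
  simp

theorem suffix_of_length_le {l l' L : List Step} (h : l <:+ L) (h' : l' <:+ L)
    (hl : l.length < l'.length) : ∃ v, v ≠ [] ∧ v ++ l = l' := by
  obtain ⟨v, rfl⟩ := List.suffix_of_suffix_length_le h h' hl.le
  refine ⟨v, ?_, rfl⟩
  rintro rfl
  simp at hl

/-- Since the walk is closed, a vertex of the right boundary is minus the displacement of what
remains; both kinds of vertices are thus described by suffixes of `L` and `R`, the lists that grow.
-/
theorem split_walk {L R : List Step} (hx : xdisp (L.reverse ++ E :: R) = 0)
    (hy : ydisp (L.reverse ++ E :: R) = 0) {k : ℕ} (hk : k ≤ (L.reverse ++ E :: R).length) :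
    (∃ l, l <:+ L ∧ l.length = k ∧ pos (L.reverse ++ E :: R) k = (xdisp l, ydisp l)) ∨
    ∃ r, r <:+ R ∧ k + r.length = L.length + R.length + 1 ∧
      pos (L.reverse ++ E :: R) k = (-xdisp r, -ydisp r) := by
  have hlen : (L.reverse ++ E :: R).length = L.length + R.length + 1 := by simp; omega
  by_cases h : k ≤ L.length
  · refine Or.inl ⟨(L.reverse.take k).reverse, ?_, by simpa using h, ?_⟩
    · rw [← List.reverse_prefix, List.reverse_reverse]
      exact List.take_prefix _ _
    · rw [pos_eq, List.take_append_of_le_length (by simpa using h)]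
      simp
  · have e := List.take_append_drop k (L.reverse ++ E :: R)
    have hr : (L.reverse ++ E :: R).drop k <:+ R := by
      obtain ⟨j, rfl⟩ := Nat.exists_eq_add_of_lt (not_le.1 h)
      rw [show L.length + j + 1 = L.reverse.length + (j + 1) by simp; omega,
        List.drop_length_add_append, List.drop_succ_cons]
      exact List.drop_suffix _ _
    refine Or.inr ⟨_, hr, ?_, ?_⟩
    · rw [List.length_drop, hlen]
      omega
    · have ex := congrArg xdisp e
      have ey := congrArg ydisp e
      rw [xdisp_append] at ex
      rw [ydisp_append] at ey
      rw [pos_eq]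
      ext
      · dsimp only; omega
      · dsimp only; omega

theorem pos_junction (L R : List Step) : pos (L.reverse ++ E :: R) (L.length + 1) =
    (xdisp L + 1, ydisp L) := by
  rw [show L.reverse ++ E :: R = (E :: L).reverse ++ R by simp,
    show L.length + 1 = (E :: L).reverse.length by simp, pos_append_length]
  simp

section Complete

variable {c : Bool} {a p m : ℕ} {L R : List Step}

theorem Grow.disp_eq_zero (h : Grow (entered c) 0 a p m L R) :
    xdisp (L.reverse ++ E :: R) = 0 ∧ ydisp (L.reverse ++ E :: R) = 0 := by
  have g := h.coords.gap
  have h1 := h.coords.heightL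
  have h2 := h.coords.heightR
  simp [Stage.isUpper, Stage.isOpen, Stage.offset] at g h1 h2 ⊢
  omega

theorem Grow.isPolygon (h : Grow (entered c) 0 a p m L R) : IsPolygon (L.reverse ++ E :: R) := by
  obtain ⟨hx, hy⟩ := h.disp_eq_zero
  have hd := h.geometry.disj
  have hc := h.coords
  have hlen : (L.reverse ++ E :: R).length = L.length + R.length + 1 := by simp; omega
  refine ⟨?_, ?_, ?_⟩
  · have g := hc.gap
    have h1 := hc.lengthL
    have h2 := hc.lengthR
    have h3 := hc.heightR
    have h4 := hd.left L List.suffix_rfl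
    have h5 := hd.right R List.suffix_rfl
    simp [Stage.isOpen, Stage.offset, Stage.extra] at g h1 h2 h3
    omega
  · rw [pos_eq, List.take_length, hx, hy]
    rfl
  · intro i j hij hj he
    rcases split_walk hx hy (hij.le.trans hj.le) with ⟨l, hl, hli, hp⟩ | ⟨r, hr, hri, hp⟩ <;>
    rcases split_walk hx hy hj.le with ⟨l', hl', hlj, hp'⟩ | ⟨r', hr', hrj, hp'⟩ <;>
    rw [hp, hp', Prod.mk.injEq] at he
    · obtain ⟨v, hv, rfl⟩ := suffix_of_length_le hl hl' (by omega)
      simp only [xdisp_append, ydisp_append] at he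
      exact hd.simpleL l v hl' hv (by omega) (by omega)
    · obtain ⟨rfl, rfl⟩ := hd.disjoint l r' hl hr' he.1 he.2
      simp only [List.length_nil] at hrj
      omega
    · have := hr.length_le
      have := hl'.length_le
      omega
    · obtain ⟨v, hv, rfl⟩ := suffix_of_length_le hr' hr (by omega)
      simp only [xdisp_append, ydisp_append] at he
      exact hd.simpleR r' v hr hv (by omega) (by omega)

theorem Grow.pos_junction (h : Grow (entered c) 0 a p m L R) :
    pos (L.reverse ++ E :: R) (L.length + 1) = (-xdisp R, ((p + m + 1 : ℕ) : ℤ)) := by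
  have g := h.coords.gap
  have h1 := h.coords.heightL
  simp [Stage.isUpper, Stage.offset] at g h1
  rw [MConvex.pos_junction, h1, g]
  push_cast
  rfl

/-- After the closing east step the right boundary goes south at once and never returns to the top,
so the left edge can be recovered from the polygon. -/
theorem Grow.le_of_top (h : Grow (entered c) 0 a p m L R) {k : ℕ}
    (hk : k ≤ (L.reverse ++ E :: R).length)
    (ht : (pos (L.reverse ++ E :: R) k).2 = (p + m + 1 : ℕ)) : k ≤ L.length + 1 := by
  obtain ⟨hx, hy⟩ := h.disp_eq_zero
  rcases split_walk hx hy hk with ⟨l, hl, hli, hp⟩ | ⟨r, hr, hri, hp⟩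
  · have := hl.length_le
    omega
  · have h1 := h.coords.heightR
    simp [Stage.isOpen] at h1
    rw [hp] at ht
    push_cast at ht
    obtain rfl := h.geometry.start (by simp) (by simp) r hr (by omega)
    omega

theorem Grow.onLeftEdge_iff (h : Grow (entered c) 0 a p m L R) (k : ℕ) :
    OnLeftEdge (p + m + 1) (L.reverse ++ E :: R) k ↔ k ≤ L.length := by
  constructor
  · rintro ⟨j, hkj, hj, ht⟩
    have := h.le_of_top hj ht
    omega
  · intro hk
    refine ⟨L.length + 1, by omega, by simp, ?_⟩
    rw [h.pos_junction]

theorem Grow.hasBox (h : Grow (entered c) 0 a p m L R) :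
    HasBox a (p + m + 1) (L.reverse ++ E :: R) := by
  obtain ⟨hx, hy⟩ := h.disp_eq_zero
  have hd := h.geometry.disj
  have hc := h.coords
  have g := hc.gap
  have h3 := hc.heightR
  have hR := hd.right R List.suffix_rfl
  simp [Stage.isOpen, Stage.offset] at g h3
  refine ⟨fun k hk => ?_, ?_, ⟨L.length + 1, by simp, by rw [h.pos_junction]⟩⟩
  · push_cast
    rcases split_walk hx hy hk with ⟨l, hl, -, hp⟩ | ⟨r, hr, -, hp⟩ <;> rw [hp]
    · have := hd.left l hl
      simp [Stage.isIndent] at this ⊢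
      omega
    · have := hd.right r hr
      dsimp only
      omega
  · obtain ⟨r, ⟨u, rfl⟩, hr⟩ := hc.far
    refine ⟨(L.reverse ++ E :: u).length, by simp, ?_⟩
    rw [show L.reverse ++ E :: (u ++ r) = (L.reverse ++ E :: u) ++ r by simp, pos_append_length]
    simp at hx ⊢
    omega

theorem Grow.leftIndented (h : Grow (entered c) 0 a p m L R) :
    LeftIndented a (p + m + 1) (L.reverse ++ E :: R) := by
  have hc := h.coords
  have hi := h.indents
  -- Two steps down of the left edge as a factorization of `L`; since `L` is reversed, the later one
  -- stands first. Index `L.length` is the closing `E`, so `j` is strictly smaller.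
  have key : ∀ i j, i < j → (L.reverse ++ E :: R)[i]? = some S →
      (L.reverse ++ E :: R)[j]? = some S → j ≤ L.length →
      ∃ u v l, L = u ++ S :: (v ++ S :: l) ∧ l.length = i ∧ (v ++ S :: l).length = j := by
    intro i j hij hwi hwj hj
    have hj' : j < L.length := by
      refine lt_of_le_of_ne hj ?_
      rintro rfl
      rw [List.getElem?_append_right (by simp)] at hwj
      simp at hwj
    rw [List.getElem?_append_left (by simp; omega)] at hwi hwj
    obtain ⟨u, l, rfl, hl⟩ := exists_of_reverse_getElem? hwj
    have : l.reverse[i]? = some S := by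
      rw [List.reverse_append, List.getElem?_append_left (by simp; omega), List.reverse_cons,
        List.getElem?_append_left (by simp; omega)] at hwi
      exact hwi
    obtain ⟨v, l', rfl, hl'⟩ := exists_of_reverse_getElem? this
    exact ⟨u, v, l', rfl, hl', hl⟩
  have height : ∀ u l, L = u ++ S :: l →
      (pos (L.reverse ++ E :: R) l.length).2 = ydisp l := by
    rintro u l rfl
    rw [show (u ++ S :: l).reverse ++ E :: R = l.reverse ++ (S :: (u.reverse ++ E :: R)) by simp,
      ← List.length_reverse (as := l), pos_append_length]
    simp
  refine ⟨?_, fun k hk => ?_, fun i j hij hwi hwj hj => ?_, fun i j hij hwi hwj hj => ?_⟩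
  · have h1 := hc.eastL
    have h2 := hc.eastR
    have g := hc.gap
    simp [Stage.offset] at g ⊢
    omega
  · rw [h.onLeftEdge_iff]
    by_contra hlt
    rw [List.getElem?_append_right (by simp; omega)] at hk
    have := List.mem_of_getElem? hk
    simp [hc.noN] at this
  · rw [h.onLeftEdge_iff] at hj
    obtain ⟨u, v, l, hL, rfl, rfl⟩ := key i j hij hwi hwj hj
    obtain ⟨v₁, v₂, rfl⟩ := List.append_of_mem (hi.pair v l ⟨u, hL.symm⟩).2
    refine ⟨(v₂ ++ S :: l).length, by simp; omega, by simp; omega, ?_⟩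
    rw [List.getElem?_append_left (by simp [hL]; omega), hL,
      show u ++ S :: (v₁ ++ N :: v₂ ++ S :: l) = (u ++ S :: v₁) ++ N :: (v₂ ++ S :: l) by simp]
    exact reverse_getElem?_length _ _ _
  · rw [h.onLeftEdge_iff] at hj
    obtain ⟨u, v, l, hL, rfl, rfl⟩ := key i j hij hwi hwj hj
    rw [height _ _ hL, height (u ++ S :: v) l (by simp [hL])]
    exact (hi.pair v l ⟨u, hL.symm⟩).1.ne

theorem Grow.mem_unimodalSet (h : Grow (entered c) 0 a p m L R) :
    L.reverse ++ E :: R ∈ unimodalSet m a (p + m + 1) := by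
  refine ⟨⟨h.isPolygon, h.hasBox, ?_, ?_⟩, h.leftIndented⟩
  · obtain ⟨L', rfl⟩ := h.coords.bottom
    simp
  · have g := h.coords.gap
    have h1 := h.coords.lengthL
    have h2 := h.coords.lengthR
    have h3 := h.coords.heightR
    simp [Stage.isOpen, Stage.offset, Stage.extra] at g h1 h2 h3 ⊢
    omega

theorem Grow.mem_staircaseSet (h : Grow (entered false) 0 a p m L R) :
    L.reverse ++ E :: R ∈ staircaseSet m a (p + m + 1) := by
  refine ⟨⟨h.mem_unimodalSet.1, L.length + 1, by simp, ?_⟩, h.leftIndented⟩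
  rw [h.pos_junction, h.coords.wide rfl]

/-- The left edge is the part of the walk before the last vertex on the top side. -/
theorem Grow.unique {c' : Bool} {L' R' : List Step} (h : Grow (entered c) 0 a p m L R)
    (h' : Grow (entered c') 0 a p m L' R')
    (e : L.reverse ++ E :: R = L'.reverse ++ E :: R') : L = L' ∧ R = R' := by
  have h1 := h'.le_of_top (k := L.length + 1) (by rw [← e]; simp)
    (by rw [← e, h.pos_junction])
  have h2 := h.le_of_top (k := L'.length + 1) (by rw [e]; simp)
    (by rw [e, h'.pos_junction])
  have := List.append_inj e (by simp; omega)
  simpa using this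

/-- In the second phase the top-right corner of the bounding rectangle is not on the polygon. -/
theorem Grow.not_corner (h : Grow (entered true) 0 a p m L R) :
    L.reverse ++ E :: R ∉ staircaseSet m a (p + m + 1) := by
  rintro ⟨⟨-, k, hk, hp⟩, -⟩
  obtain ⟨hx, hy⟩ := h.disp_eq_zero
  have g := h.coords.gap
  have h3 := h.coords.heightR
  have h7 := h.coords.eastR
  have hE : E ∈ R := (h.shape.2.2).2 rfl
  have hE := List.count_pos_iff.2 hE
  simp [Stage.isOpen, Stage.offset] at g h3
  rcases split_walk hx hy hk with ⟨l, hl, hli, hp'⟩ | ⟨r, hr, hri, hp'⟩ <;>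
    rw [hp', Prod.mk.injEq] at hp
  · have := h.geometry.disj.left l hl
    omega
  · push_cast at hp
    obtain rfl := h.geometry.start (by simp) (by simp) r hr (by omega)
    omega

end Complete

end MConvex

namespace MConvex

open Step Stage

/-! ### Decomposition of a polygon -/

theorem xdisp_eq_count (w : List Step) : xdisp w = w.count E - w.count W := by
  induction w with
  | nil => simp
  | cons s w ih => cases s <;> simp [ih] <;> omega

/-- The boundary walk of a polygon with all indents vertical, on the left, and at different
heights, split into the left edge `A` and the right boundary `B`. -/
structure IsSplit (a b : ℕ) (A B : List Step) : Prop where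
  simple : ∀ u v z, A ++ B = u ++ (v ++ z) → v ≠ [] → z ≠ [] → xdisp v = 0 → ydisp v ≠ 0
  long : 4 ≤ (A ++ B).length
  xclosed : xdisp A + xdisp B = 0
  yclosed : ydisp A + ydisp B = 0
  box : ∀ u z, A ++ B = u ++ z → 0 ≤ xdisp u ∧ xdisp u ≤ a ∧ 0 ≤ ydisp u ∧ ydisp u ≤ b
  right : ∃ u z, A ++ B = u ++ z ∧ xdisp u = a
  east : (A ++ B).count E = a
  top : ydisp A = b
  last : ∀ u z, B = u ++ z → u ≠ [] → ydisp u < 0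
  head : ∃ A', A = N :: A'
  noN : N ∉ B
  depth : ∀ u v z, A = u ++ S :: (v ++ S :: z) → N ∈ v
  heights : ∀ u v z, A = u ++ S :: (v ++ S :: z) → ydisp u ≠ ydisp (u ++ S :: v)

/-- A discrete intermediate value theorem: heights along `z` change by at most one per step. -/
theorem exists_suffix_height {z : List Step} (hN : N ∉ z) {h : ℤ} (h0 : 0 ≤ h)
    (hz : h ≤ -ydisp z) : ∃ u z', z = u ++ z' ∧ -ydisp z' = h := by
  induction z with
  | nil => exact ⟨[], [], rfl, by simp at hz ⊢; omega⟩
  | cons c z ih =>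
    simp only [List.mem_cons, not_or] at hN
    by_cases he : -ydisp (c :: z) = h
    · exact ⟨[], _, rfl, he⟩
    · obtain ⟨u, z', rfl, h'⟩ := ih hN.2 (by cases c <;> simp_all; omega)
      exact ⟨c :: u, z', rfl, h'⟩

namespace IsSplit

variable {a b : ℕ} {A B : List Step} (H : IsSplit a b A B)

include H

/-- No vertex of the left edge, apart from its end, is on the right boundary, except the origin. -/
theorem ne_of_split {u z u' z' : List Step} (hA : A = u ++ z) (hz : z ≠ []) (hB : B = u' ++ z')
    (hne : u ≠ [] ∨ z' ≠ []) (hx : xdisp u = -xdisp z') : ydisp u ≠ -ydisp z' := by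
  intro hy
  have h1 := H.xclosed
  have h2 := H.yclosed
  rw [hA, hB] at h1 h2
  simp only [xdisp_append, ydisp_append] at h1 h2
  by_cases hz' : z' = []
  · subst hz'
    simp only [ne_eq, not_true_eq_false, or_false] at hne
    refine H.simple [] u (z ++ B) (by simp [hA]) hne (by simp [hz]) (by simpa using hx)
      (by simpa using hy)
  · refine H.simple u (z ++ u') z' (by simp [hA, hB]) (by simp [hz]) hz' ?_ ?_
    · simp only [xdisp_append]; omega
    · simp only [ydisp_append]; omega

theorem backtrack {u z : List Step} {s t : Step} (h : A ++ B = u ++ ([s, t] ++ z))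
    (hx : xdisp [s, t] = 0) (hy : ydisp [s, t] = 0) : False := by
  -- If the reversal ends the walk, `simple` does not apply to it; then `u` is already closed, and
  -- nonempty because the walk has at least four steps.
  by_cases hz : z = []
  · subst hz
    have h1 := congrArg xdisp h
    have h2 := congrArg ydisp h
    have h3 := H.xclosed
    have h4 := H.yclosed
    have h5 := H.long
    rw [h] at h5
    simp only [xdisp_append, ydisp_append, List.append_nil] at h1 h2
    refine H.simple [] u [s, t] (by simpa using h) ?_ (by simp) (by omega) (by omega)
    rintro rfl
    simp at h5
  · exact H.simple u [s, t] z h (by simp) hz hx hy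

theorem box_right {u' z' : List Step} (hB : B = u' ++ z') :
    0 ≤ -xdisp z' ∧ -xdisp z' ≤ a ∧ 0 ≤ -ydisp z' ∧ -ydisp z' ≤ b := by
  have h1 := H.xclosed
  have h2 := H.yclosed
  have h3 := H.box (A ++ u') z' (by simp [hB])
  rw [hB] at h1 h2
  simp only [xdisp_append, ydisp_append] at h1 h2 h3
  omega

/-- The left edge is to the left of the right boundary. -/
theorem left_of_right (u : List Step) : ∀ z, A = u ++ z → u ≠ [] → z ≠ [] →
    ∀ u' z', B = u' ++ z' → ydisp u = -ydisp z' → xdisp u < -xdisp z' := by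
  -- A discrete Jordan argument along the left edge: no single step can pass from the left of the
  -- right boundary to its right without a common vertex.
  induction u using List.reverseRecOn with
  | nil => exact fun _ _ h => absurd rfl h
  | append_singleton u s ih =>
    intro z hA hu hz
    have ne : ∀ u' z', B = u' ++ z' → xdisp (u ++ [s]) = -xdisp z' →
        ydisp (u ++ [s]) ≠ -ydisp z' := fun u' z' hB => H.ne_of_split hA hz hB (Or.inl hu)
    by_cases hu0 : u = []
    · subst hu0
      intro u' z' hB hy
      obtain ⟨A', hA'⟩ := H.head
      obtain rfl : s = N := by
        rw [hA'] at hA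
        exact (List.cons.inj hA).1.symm
      have h1 := ne u' z' hB
      have h2 := H.box_right hB
      simp at hy h1 ⊢
      omega
    have ih := ih (s :: z) (by simpa using hA) hu0 (by simp)
    have hbox := H.box u (s :: z ++ B) (by simp [hA])
    cases s with
    | E =>
      intro u' z' hB hy
      have h1 := ne u' z' hB
      simp at hy h1 ⊢
      have h2 := ih u' z' hB hy
      omega
    | W =>
      intro u' z' hB hy
      simp at hy ⊢
      have h2 := ih u' z' hB hy
      simp; omega
    | N =>
      intro u' z'
      -- At the new height the right boundary is followed from the origin side: an `S` refers back
      -- to the previous height, and a horizontal step cannot jump over the vertex. After a step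
      -- down it is followed from the top instead.
      induction z' generalizing u' with
      | nil =>
        intro _ hy
        simp at hy
        omega
      | cons c z' ih' =>
        intro hB hy
        have h1 := ne u' (c :: z') hB
        have h2 := ih' (u' ++ [c]) (by simpa using hB)
        have h3 := ih (u' ++ [c]) z' (by simpa using hB)
        have hc : c ≠ N := by
          rintro rfl
          exact H.noN (by simp [hB])
        cases c <;> simp at hc hy h1 h2 h3 ⊢ <;> omega
    | S =>
      intro u'
      induction u' using List.reverseRecOn with
      | nil =>
        intro z' hB hy
        have h1 := H.yclosed
        have h2 := H.top
        simp at hB hy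
        subst hB
        omega
      | append_singleton u' c ih' =>
        intro z' hB hy
        have h1 := ne (u' ++ [c]) z' hB
        have h2 := ih' (c :: z') (by simpa using hB)
        have h3 := ih u' (c :: z') (by simpa using hB)
        have hc : c ≠ N := by
          rintro rfl
          exact H.noN (by simp [hB])
        cases c <;> simp at hc hy h1 h2 h3 ⊢ <;> omega

/-- A prefix reaching the right side has used up all `a` east steps and contains no west step. -/
theorem no_west_before_east {u v z : List Step} (h : A ++ B = u ++ W :: (v ++ E :: z)) :
    False := by
  obtain ⟨u', z', h', hx⟩ := H.right
  have h1 := H.east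
  have h2 := xdisp_eq_count u'
  have h3 : (A ++ B).count E = u'.count E + z'.count E := by rw [h', List.count_append]
  have h4 : z'.count E = 0 := by omega
  have h5 : u'.count W = 0 := by omega
  rw [h'] at h
  rcases List.append_eq_append_iff.1 h with ⟨t, rfl, ht⟩ | ⟨t, rfl, ht⟩
  · rw [ht] at h4
    simp at h4
  · cases t with
    | nil =>
      simp at ht
      rw [← ht] at h4
      simp at h4
    | cons c t =>
      rw [List.cons_append, List.cons.injEq] at ht
      rw [← ht.1] at h5
      simp at h5

/-- By the same count, a west step on the left edge comes after the left edge has met the right side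
of the box. There the right boundary, strictly further right, would leave the box. -/
theorem no_west : W ∉ A := by
  intro hW
  obtain ⟨u, z, hA⟩ := List.append_of_mem hW
  obtain ⟨u', z', h', hx⟩ := H.right
  have h1 := H.east
  have h2 := xdisp_eq_count u'
  have h3 : (A ++ B).count E = u'.count E + z'.count E := by rw [h', List.count_append]
  have h5 : u'.count W = 0 := by omega
  have key : ∃ t, u = u' ++ t := by
    rw [hA, List.append_assoc] at h'
    rcases List.append_eq_append_iff.1 h' with ⟨t, rfl, ht⟩ | ⟨t, rfl, ht⟩
    · cases t with
      | nil => exact ⟨[], by simp⟩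
      | cons c t =>
        simp only [List.cons_append, List.cons.injEq] at ht
        rw [← ht.1] at h5
        simp at h5
    · exact ⟨t, rfl⟩
  obtain ⟨t, rfl⟩ := key
  by_cases hu : u' = []
  · subst hu
    have h6 := H.box (t ++ [W]) (z ++ B) (by simp [hA])
    have h7 := H.box t (W :: z ++ B) (by simp [hA])
    simp at hx h6 h7
    omega
  · have h6 := H.box u' (t ++ W :: z ++ B) (by simp [hA])
    have h8 := H.yclosed
    have h9 := H.top
    obtain ⟨v, v', hB, hv⟩ := exists_suffix_height H.noN (h := ydisp u') h6.2.2.1 (by omega)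
    have h7 := H.left_of_right u' (t ++ W :: z) (by simp [hA]) hu (by simp) v v' hB hv.symm
    have h10 := H.box_right hB
    omega

end IsSplit

/-! ### Recognizing an indent in the left edge -/

/-- Rises between the steps down compensate all of them but the first. The two bounds are proved
together, as removing a leading `S` leads from the first to the second. -/
theorem neg_one_le_ydisp {v : List Step} :
    ((∀ x y z, v = x ++ S :: (y ++ S :: z) → N ∈ y) → -1 ≤ ydisp v) ∧
    ((∀ x y z, v = x ++ S :: (y ++ S :: z) → N ∈ y) → (∀ y z, v = y ++ S :: z → N ∈ y) →
      0 ≤ ydisp v) := by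
  induction v with
  | nil => simp
  | cons c v ih =>
    have tail : (∀ x y z, c :: v = x ++ S :: (y ++ S :: z) → N ∈ y) →
        ∀ x y z, v = x ++ S :: (y ++ S :: z) → N ∈ y :=
      fun h x y z e => h (c :: x) y z (by simp [e])
    have tail' : c ≠ N → (∀ y z, c :: v = y ++ S :: z → N ∈ y) → ∀ y z, v = y ++ S :: z → N ∈ y := by
      intro hc h y z e
      have := h (c :: y) z (by simp [e])
      simpa [hc.symm] using this
    refine ⟨fun h => ?_, fun h h' => ?_⟩
    · have h1 := ih.1 (tail h)
      cases c with
      | S =>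
        have := ih.2 (tail h) fun y z e => h [] y z (by simp [e])
        simp; omega
      | _ => simp; omega
    · have h1 := ih.1 (tail h)
      cases c with
      | S => simpa using h' [] v rfl
      | N => simp; omega
      | _ => simpa using ih.2 (tail h) (tail' (by simp) h')

theorem exists_first_descent {u : List Step} {t : ℤ} (ht : 0 ≤ t) (h : t + ydisp u < 0) :
    ∃ y z, u = y ++ S :: z ∧ t + ydisp y = 0 := by
  induction u generalizing t with
  | nil => simp at h; omega
  | cons c u ih =>
    cases c with
    | S =>
      by_cases h0 : t = 0
      · exact ⟨[], u, rfl, by simp [h0]⟩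
      · obtain ⟨y, z, rfl, e⟩ := ih (t := t - 1) (by omega) (by simp at h; omega)
        exact ⟨S :: y, z, rfl, by simp; omega⟩
    | N =>
      obtain ⟨y, z, rfl, e⟩ := ih (t := t + 1) (by omega) (by simp at h; omega)
      exact ⟨N :: y, z, rfl, by simp; omega⟩
    | E =>
      obtain ⟨y, z, rfl, e⟩ := ih ht (by simpa using h)
      exact ⟨E :: y, z, rfl, by simpa using e⟩
    | W =>
      obtain ⟨y, z, rfl, e⟩ := ih ht (by simpa using h)
      exact ⟨W :: y, z, rfl, by simpa using e⟩

/-- If the first vertical step were `N`, the walk after it could lose at most one unit and would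
never get below its start. -/
theorem exists_east_south {v : List Step} (hW : W ∉ v)
    (hd : ∀ x y z, v = x ++ S :: (y ++ S :: z) → N ∈ y) (hlow : ∀ u, u <+: v → -1 ≤ ydisp u)
    (hu : ∃ u, u <+: v ∧ ydisp u < 0) : ∃ k r, v = List.replicate k E ++ S :: r := by
  induction v with
  | nil =>
    obtain ⟨u, hu, h⟩ := hu
    rw [List.prefix_nil.1 hu] at h
    simp at h
  | cons c v ih =>
    obtain ⟨u, ⟨t, ht⟩, hneg⟩ := hu
    obtain ⟨c', u, rfl⟩ := List.exists_cons_of_ne_nil (l := u) (by rintro rfl; simp at hneg)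
    rw [List.cons_append, List.cons.injEq] at ht
    obtain ⟨rfl, rfl⟩ := ht
    cases c' with
    | S => exact ⟨0, _, rfl⟩
    | W => simp at hW
    | E =>
      obtain ⟨k, r, h⟩ := ih (fun h => hW (List.mem_cons_of_mem _ h))
        (fun x y z e => hd (E :: x) y z (by simp [e]))
        (fun u' h' => by simpa using hlow (E :: u') (by simpa using h'))
        ⟨u, List.prefix_append _ _, by simpa using hneg⟩
      exact ⟨k + 1, r, by simp [h, List.replicate_succ]⟩
    | N =>
      have := (neg_one_le_ydisp (v := u)).1 fun x y z e =>
        hd (N :: x) y (z ++ t) (by simp [e])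
      simp at hneg
      omega

theorem exists_east_north {v : List Step} (hW : W ∉ v) (hd : ∀ y z, v = y ++ S :: z → N ∈ y)
    (h : 0 < ydisp v) : ∃ k r, v = List.replicate k E ++ N :: r := by
  induction v with
  | nil => simp at h
  | cons c v ih =>
    cases c with
    | N => exact ⟨0, _, rfl⟩
    | W => simp at hW
    | S => simpa using hd [] v rfl
    | E =>
      obtain ⟨k, r, h⟩ := ih (fun h => hW (List.mem_cons_of_mem _ h))
        (fun y z e => by simpa using hd (E :: y) z (by simp [e])) (by simpa using h)
      exact ⟨k + 1, r, by simp [h, List.replicate_succ]⟩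

@[simp] theorem xdisp_replicate_E (k : ℕ) : xdisp (List.replicate k E) = k := by
  induction k with
  | zero => rfl
  | succ k ih => simp [List.replicate_succ, ih]

@[simp] theorem ydisp_replicate_E (k : ℕ) : ydisp (List.replicate k E) = 0 := by
  induction k with
  | zero => rfl
  | succ k ih => simp [List.replicate_succ, ih]

/-- When the left edge comes back to the bottom of a row, this is an indent. -/
theorem IsSplit.exists_indent {a b : ℕ} {A B U V : List Step} (H : IsSplit a b A B)
    (hA : A = U ++ N :: V) (hlow : ∀ u, u <+: V → -1 ≤ ydisp u)
    (hu : ∃ u, u <+: V ∧ ydisp u < 0) :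
    ∃ k l V', V = List.replicate (k + 1) E ++ S :: (List.replicate (l + 1) E ++ N :: V') ∧
      ∀ u, u <+: V' → 0 ≤ ydisp u := by
  have hW : W ∉ V := fun h => H.no_west (by simp [hA, h])
  obtain ⟨k, r, rfl⟩ := exists_east_south hW
    (fun x y z e => H.depth (U ++ N :: x) y z (by simp [hA, e])) hlow hu
  have hbox := H.box (U ++ [N]) (List.replicate k E ++ S :: r ++ B) (by simp [hA])
  have htop := H.top
  rw [hA] at htop
  simp at hbox htop
  obtain ⟨l, V', rfl⟩ := exists_east_north (v := r) (fun h => hW (by simp [h]))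
    (fun y z e => H.depth (U ++ N :: List.replicate k E) y z (by simp [hA, e])) (by omega)
  -- Both levels of an indent contain an east step, since `N, S` and `S, N` would be immediate
  -- reversals.
  cases k with
  | zero =>
    exact (H.backtrack (u := U) (s := N) (t := S) (z := List.replicate l E ++ N :: (V' ++ B))
      (by simp [hA]) rfl rfl).elim
  | succ k =>
  cases l with
  | zero =>
    exact (H.backtrack (u := U ++ N :: List.replicate (k + 1) E) (s := S) (t := N) (z := V' ++ B)
      (by simp [hA]) rfl rfl).elim
  | succ l =>
  refine ⟨k, l, V', rfl, ?_⟩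
  rintro u ⟨t, rfl⟩
  by_contra hneg
  -- The first later step down that leaves the new level would start at the height of the first
  -- indent.
  obtain ⟨y, z, rfl, hy⟩ := exists_first_descent (u := u) (t := 0) le_rfl (by omega)
  refine H.heights (U ++ N :: List.replicate (k + 1) E) (List.replicate (l + 1) E ++ N :: y)
    (z ++ t) (by simp [hA]) ?_
  simp at hy ⊢
  omega

theorem Grow.upper_chain {c : Bool} {d a p m : ℕ} {L R : List Step} (k : ℕ)
    (h : Grow (entered c) (d + (k + 1)) a p m L R) :
    Grow (upper c) d a p m (List.replicate (k + 1) E ++ N :: L) R := by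
  induction k generalizing d with
  | zero => exact .indent h
  | succ k ih => exact .eastUpper (ih (by rwa [show d + 1 + (k + 1) = d + (k + 1 + 1) by omega]))

theorem Grow.lower_chain {c : Bool} {d a p m : ℕ} {L R : List Step} (l : ℕ)
    (h : Grow (upper c) (d + (l + 1)) a p m L R) :
    Grow (lower c) d a p m (List.replicate (l + 1) E ++ S :: L) R := by
  induction l generalizing d with
  | zero => exact .descend h
  | succ l ih => exact .eastLower (ih (by rwa [show d + 1 + (l + 1) = d + (l + 1 + 1) by omega]))

/-! ### Reading the construction off a polygon -/

/-- The stages in which the two walks are extended by whole rows. -/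
def Stage.IsRegular (B : List Step) : Stage → Prop
  | widening => B.getLast? ≠ some E
  | shrinking | entered _ => True
  | _ => False

namespace IsSplit

variable {a b : ℕ} {A B : List Step} (H : IsSplit a b A B)

include H

theorem right_ne_nil {A' B' L R : List Step} (hA : A = L.reverse ++ A') (hB : B = B' ++ R)
    (h : -ydisp R < ydisp L) : B' ≠ [] := by
  rintro rfl
  have h1 := H.yclosed
  have h2 := H.top
  have h3 := H.box L.reverse (A' ++ B) (by simp [hA])
  simp at hB h3
  subst hB
  omega

/-- Below a step up of the left edge, the right boundary does not come as far as the left edge. -/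
theorem gap_pos {A' B' L R : List Step} (hA : A = (N :: L).reverse ++ A')
    (hB : B = B' ++ [E] ++ R) (h : -ydisp R = ydisp L) : -xdisp R ≠ xdisp L + 1 := by
  intro hx
  refine H.ne_of_split (u := L.reverse) (z := N :: A') (u' := B') (z' := E :: R) (by simp [hA])
    (by simp) (by simp [hB]) (by simp) ?_ ?_
  · simp; omega
  · simp; omega

/-- The unread steps determine the next rule. The induction is on their number; the invariant is
that the rest of the left edge never falls below the current height, so finished rows are not
revisited. -/
theorem exists_grow (n : ℕ) : ∀ A' B' L R, A'.length + B'.length = n → A = L.reverse ++ A' →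
    B = B' ++ R → (∀ u, u <+: A' → 0 ≤ ydisp u) →
    ∀ s d a' p m, Stage.IsRegular B' s → Grow s d a' p m L R →
    ∃ c a' p m L' R', Grow (entered c) 0 a' p m L' R' ∧ A ++ B = L'.reverse ++ E :: R' := by
  induction n using Nat.strong_induction_on with
  | _ n ih =>
  intro A' B' L R hn hA hB hlow s d a' p m hs h
  have raised_case : ∀ A₁ L₁ d₁ p₁ m₁ c, A₁.length < A'.length → A = L₁.reverse ++ A₁ →
      (∀ u, u <+: A₁ → 0 ≤ ydisp u) → Grow (raised c) d₁ a' p₁ m₁ L₁ R →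
      ∃ c a' p m L' R', Grow (entered c) 0 a' p m L' R' ∧ A ++ B = L'.reverse ++ E :: R' := by
    intro A₁ L₁ d₁ p₁ m₁ c hlen hA₁ hlow₁ hg
    cases c with
    | true => exact ih _ (by omega) A₁ B' L₁ R rfl hA₁ hB hlow₁ shrinking d₁ a' p₁ m₁ trivial hg.keep
    | false =>
      by_cases hl : B'.getLast? = some E
      · obtain ⟨B₁, rfl⟩ := List.getLast?_eq_some_iff.1 hl
        cases d₁ with
        | zero =>
          exfalso
          obtain ⟨L₂, rfl⟩ := List.head?_eq_some_iff.1 hg.shape.1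
          have g := hg.coords.gap
          have h1 := hg.coords.heightL
          have h2 := hg.coords.heightR
          simp [Stage.isUpper, Stage.isOpen, Stage.offset] at g h1 h2
          exact H.gap_pos hA₁ hB (by omega) g
        | succ d₁ =>
          exact ih _ (by simp at hn; omega) A₁ B₁ L₁ (E :: R) rfl hA₁ (by simp [hB]) hlow₁
            shrinking d₁ a' p₁ m₁ trivial hg.turn
      -- `settle` is only chosen when the right boundary does not turn in this row; this is the
      -- content of `Stage.IsRegular` for `widening`.
      · exact ih _ (by omega) A₁ B' L₁ R rfl hA₁ hB hlow₁ widening _ a' p₁ m₁ hl hg.settle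
  have g := h.coords.gap
  have h1 := h.coords.heightL
  have h2 := h.coords.heightR
  cases s with
  | widening =>
    simp [Stage.isUpper, Stage.isOpen, Stage.offset] at g h1 h2
    obtain ⟨B₁, c, rfl⟩ := List.eq_nil_or_concat B' |>.resolve_left
      (H.right_ne_nil hA hB (by omega))
    cases c with
    | N => exact (H.noN (by simp [hB])).elim
    | E => simp [Stage.IsRegular] at hs
    | W =>
      refine ih _ (by simp at hn; omega) A' B₁ L (W :: R) rfl hA (by simp [hB]) hlow
        widening (d + 1) (a' + 1) p m ?_ h.widen
      intro hl
      obtain ⟨B₂, rfl⟩ := List.getLast?_eq_some_iff.1 hl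
      exact H.backtrack (u := A ++ B₂) (s := E) (t := W) (z := R) (by simp [hB]) rfl rfl
    | S =>
      cases d with
      | zero =>
        exfalso
        obtain ⟨L₁, rfl⟩ := List.head?_eq_some_iff.1 h.shape.1
        simp at g h1
        by_cases hA' : A' = []
        · subst hA'
          have hB₁ : B₁ = [] := by
            by_contra hne
            have h3 := H.last B₁ (S :: R) (by simp [hB]) hne
            have h4 := H.yclosed
            rw [hA, hB] at h4
            simp at h4
            omega
          subst hB₁
          exact H.backtrack (u := L₁.reverse) (s := N) (t := S) (z := R)
            (by simp [hA, hB]) rfl rfl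
        · refine H.ne_of_split (u := (N :: L₁).reverse) (u' := B₁) (z' := S :: R) hA hA'
            (by simp [hB]) (by simp) ?_ ?_
          · simp; omega
          · simp; omega
      | succ d =>
        exact ih _ (by simp at hn; omega) A' B₁ L (S :: R) rfl hA (by simp [hB]) hlow
          (entered false) d a' p m trivial h.enterWide
  | shrinking =>
    simp [Stage.isUpper, Stage.isOpen, Stage.offset] at g h1 h2
    obtain ⟨B₁, c, rfl⟩ := List.eq_nil_or_concat B' |>.resolve_left
      (H.right_ne_nil hA hB (by omega))
    cases c with
    | N => exact (H.noN (by simp [hB])).elim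
    | W =>
      obtain ⟨u, v, rfl⟩ := List.append_of_mem h.shape.2
      exact (H.no_west_before_east (u := A ++ B₁) (v := u) (z := v) (by simp [hB])).elim
    | E =>
      cases d with
      | zero =>
        exfalso
        obtain ⟨L₁, rfl⟩ := List.head?_eq_some_iff.1 h.shape.1
        simp at g h1
        exact H.gap_pos hA (by simpa using hB) (by omega) (by omega)
      | succ d =>
        exact ih _ (by simp at hn; omega) A' B₁ L (E :: R) rfl hA (by simp [hB]) hlow
          shrinking d a' p m trivial h.shrink
    | S =>
      exact ih _ (by simp at hn; omega) A' B₁ L (S :: R) rfl hA (by simp [hB]) hlow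
        (entered true) d a' p m trivial h.enterShrink
  | entered c =>
    simp [Stage.isUpper, Stage.isOpen, Stage.offset] at g h1 h2
    have htop := H.top
    have hlast : A' = [] ∨ (∃ s, A' = [s] ∧ ydisp [s] = 0) → B' = [] := by
      intro hA'
      by_contra hne
      have h3 := H.last B' R hB hne
      have h4 := H.yclosed
      rw [hA, hB] at h4
      rcases hA' with rfl | ⟨s, rfl, hs⟩ <;> simp at h4 <;> omega
    cases A' with
    | nil =>
      have hB' := hlast (Or.inl rfl)
      subst hB'
      have h4 := H.xclosed
      rw [hA, hB] at h4
      simp at h4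
      omega
    | cons t A₁ =>
    cases t with
    | W => exact (H.no_west (by simp [hA])).elim
    | S =>
      have := hlow [S] (by simp)
      simp at this
    | E =>
      cases d with
      | succ d =>
        refine ih _ (by simp at hn; omega) A₁ B' (E :: L) R rfl (by simp [hA]) hB ?_
          (entered c) d a' p m trivial h.east
        intro u hu
        simpa using hlow (E :: u) (by simpa using hu)
      | zero =>
        -- The gap is one, so this east step lands on the start of `R`: the left edge must end here.
        have hA₁ : A₁ = [] := by
          by_contra hne
          refine H.ne_of_split (u := (E :: L).reverse) (z := A₁) (by simp [hA]) hne hB (by simp)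
            ?_ ?_
          · simp; omega
          · simp; omega
        subst hA₁
        have hB' := hlast (Or.inr ⟨E, rfl, rfl⟩)
        subst hB'
        exact ⟨c, a', p, m, L, R, h, by simp [hA, hB]⟩
    | N =>
      have hlow₁ : ∀ u, u <+: A₁ → -1 ≤ ydisp u := by
        intro u hu
        have := hlow (N :: u) (by simpa using hu)
        simp at this
        omega
      -- A return below the new level means that the row is crossed three times.
      by_cases hret : ∃ u, u <+: A₁ ∧ ydisp u < 0
      · obtain ⟨k, l, A₂, rfl, hlow₂⟩ := H.exists_indent hA hlow₁ hret
        have hx := H.left_of_right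
          (L.reverse ++ N :: (List.replicate (k + 1) E ++ S :: List.replicate (l + 1) E))
          (N :: A₂) (by simp [hA]) (by simp) (by simp) B' R hB (by simp; omega)
        simp only [xdisp_append, xdisp_reverse, xdisp_N, xdisp_S, xdisp_replicate_E] at hx
        -- The end of the lower level is strictly left of the start of `R`, so the gap has room for
        -- all east steps of both levels.
        obtain ⟨e, rfl⟩ : ∃ e, d = e + (l + 1) + (k + 1) :=
          ⟨d - (l + 1) - (k + 1), by push_cast at hx; omega⟩
        exact raised_case A₂ _ e p (m + 1) c (by simp; omega) (by simp [hA]) hlow₂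
          (.raiseIndent (.lower_chain l (.upper_chain k h)))
      · push Not at hret
        exact raised_case A₁ _ d (p + 1) m c (by simp) (by simp [hA]) hret h.raise
  | upper | lower | raised => exact hs.elim

theorem exists_grow_entered :
    ∃ c a' p m L R, Grow (entered c) 0 a' p m L R ∧ A ++ B = L.reverse ++ E :: R := by
  obtain ⟨A', rfl⟩ := H.head
  refine H.exists_grow _ A' B [N] [] rfl rfl (by simp) ?_ widening 0 0 0 0 ?_ .base
  · rintro u ⟨t, rfl⟩
    -- A return of the left edge to the bottom side would be strictly left of the origin.
    by_contra hneg
    have h1 := H.box (N :: u) (t ++ B) (by simp)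
    have h2 := H.top
    have h4 := H.box (N :: (u ++ t)) B (by simp)
    have h3 := H.left_of_right (N :: u) t (by simp) (by simp) (by
      rintro rfl
      have h5 : b ≠ 0 := by
        have := H.box [N] (u ++ B) (by simp)
        simp at this
        omega
      simp at h2 h1
      omega) B [] (by simp) (by simp at h1 ⊢; omega)
    simp at h3 h1
    omega
  · intro hl
    obtain ⟨B', rfl⟩ := List.getLast?_eq_some_iff.1 hl
    have := H.box_right (u' := B') (z' := [E]) rfl
    simp at this

end IsSplit

end MConvex

namespace MConvex

open Step Stage

/-! ### The generating functions -/

theorem exists_isSplit {m a b : ℕ} {w : List Step} (h : w ∈ unimodalSet m a b) :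
    ∃ A B, w = A ++ B ∧ IsSplit a b A B := by
  classical
  obtain ⟨⟨⟨hlen, hclosed, hsimple⟩, ⟨hin, ⟨kr, hkr, hr⟩, ⟨kt, hkt, ht⟩⟩, hN, -⟩, h1, h2, h3, h4⟩ := h
  have pos_split : ∀ u z, w = u ++ z → pos w u.length = (xdisp u, ydisp u) := by
    rintro u z rfl
    exact pos_append_length u z
  -- The cut is at the last visit to the top side.
  obtain ⟨T, hT, hTb, hTmax⟩ : ∃ T, T ≤ w.length ∧ (pos w T).2 = b ∧
      ∀ k ≤ w.length, T < k → (pos w k).2 ≠ b :=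
    ⟨_, Nat.findGreatest_le _, Nat.findGreatest_spec (P := fun k => (pos w k).2 = b) hkt ht,
      fun k hk hlt => Nat.findGreatest_is_greatest hlt hk⟩
  obtain ⟨A, B, rfl, rfl⟩ : ∃ A B, w = A ++ B ∧ A.length = T :=
    ⟨_, _, (List.take_append_drop T w).symm, by simpa using hT⟩
  have hA := pos_split A B rfl
  have hcl := pos_split (A ++ B) [] (by simp)
  rw [hclosed, Prod.ext_iff] at hcl
  simp only [xdisp_append, ydisp_append, Prod.fst_zero, Prod.snd_zero] at hcl
  have box : ∀ u z, A ++ B = u ++ z → 0 ≤ xdisp u ∧ xdisp u ≤ a ∧ 0 ≤ ydisp u ∧ ydisp u ≤ b := by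
    intro u z e
    have := hin u.length (by rw [e]; simp)
    rwa [pos_split u z e] at this
  have last : ∀ u z, B = u ++ z → u ≠ [] → ydisp u < 0 := by
    intro u z e hu
    have h5 := hTmax (A ++ u).length (by simp [e]) (by simpa using List.length_pos_iff.2 hu)
    have h6 := box (A ++ u) z (by simp [e])
    rw [pos_split (A ++ u) z (by simp [e])] at h5
    rw [hA] at hTb
    simp only [xdisp_append, ydisp_append] at h5 h6 hTb
    omega
  refine ⟨A, B, rfl, ?_, hlen, hcl.1.symm, hcl.2.symm, box, ?_, h1, by rw [hA] at hTb; exact hTb,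
    last, ?_, ?_, ?_, ?_⟩
  · intro u v z e hv hz hx hy
    have hv := List.length_pos_iff.2 hv
    have hz := List.length_pos_iff.2 hz
    refine hsimple u.length (u ++ v).length (by simpa using hv) (by rw [e]; simp; omega) ?_
    rw [pos_split u _ e, pos_split (u ++ v) z (by simpa using e)]
    simp [hx, hy]
  · refine ⟨(A ++ B).take kr, (A ++ B).drop kr, (List.take_append_drop _ _).symm, ?_⟩
    have := pos_split _ _ (List.take_append_drop kr (A ++ B)).symm
    rw [List.length_take_of_le hkr] at this
    rw [← hr, this]
  · cases A with
    | nil =>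
      exfalso
      obtain ⟨w', hw⟩ := List.head?_eq_some_iff.1 hN
      have := box [N] w' (by simpa using hw)
      rw [hA] at hTb
      simp at hTb this
      omega
    | cons s A' =>
      simp at hN
      exact ⟨A', by rw [hN]⟩
  · intro hmem
    obtain ⟨u, z, rfl⟩ := List.append_of_mem hmem
    obtain ⟨j, hj, hjl, hjb⟩ := h2 (A ++ u).length (by simp)
    exact hTmax j hjl (by simp at hj; omega) hjb
  · rintro u v z rfl
    obtain ⟨k, hk1, hk2, hk⟩ := h3 u.length (u ++ S :: v).length (by simp) (by simp)
      (by
        rw [show u ++ S :: (v ++ S :: z) ++ B = (u ++ S :: v) ++ S :: (z ++ B) by simp,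
          List.getElem?_append_right le_rfl]
        simp) ⟨_, by simp, hT, hTb⟩
    rw [show u ++ S :: (v ++ S :: z) ++ B = (u ++ [S]) ++ (v ++ (S :: z ++ B)) by simp,
      List.getElem?_append_right (by simp; omega),
      List.getElem?_append_left (by simp at hk2 ⊢; omega)] at hk
    exact List.mem_of_getElem? hk
  · rintro u v z rfl
    have := h4 u.length (u ++ S :: v).length (by simp) (by simp)
      (by
        rw [show u ++ S :: (v ++ S :: z) ++ B = (u ++ S :: v) ++ S :: (z ++ B) by simp,
          List.getElem?_append_right le_rfl]
        simp) ⟨_, by simp, hT, hTb⟩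
    rwa [pos_split u (S :: (v ++ S :: z) ++ B) (by simp),
      pos_split (u ++ S :: v) (S :: z ++ B) (by simp)] at this

theorem HasBox.unique {a b a' b' : ℕ} {w : List Step} (h : HasBox a b w) (h' : HasBox a' b' w) :
    a = a' ∧ b = b' := by
  obtain ⟨k, hk, e⟩ := h.right
  obtain ⟨k', hk', e'⟩ := h'.right
  obtain ⟨j, hj, f⟩ := h.top
  obtain ⟨j', hj', f'⟩ := h'.top
  have := h.inside k' hk'
  have := h'.inside k hk
  have := h.inside j' hj'
  have := h'.inside j hj
  omega

theorem mem_unimodalSet_iff {m a b : ℕ} {w : List Step} : w ∈ unimodalSet m a b ↔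
    ∃ c p L R, b = p + m + 1 ∧ Grow (entered c) 0 a p m L R ∧ w = L.reverse ++ E :: R := by
  constructor
  · intro h
    obtain ⟨A, B, rfl, H⟩ := exists_isSplit h
    obtain ⟨c, a', p, m', L, R, hg, e⟩ := H.exists_grow_entered
    have h' := hg.mem_unimodalSet
    rw [← e] at h'
    -- The construction comes with its own parameters; the bounding box fixes width and height, and
    -- then the perimeter fixes `m`.
    obtain ⟨rfl, rfl⟩ := h.1.box.unique h'.1.box
    have h1 := h.1.perimeter
    have h2 := h'.1.perimeter
    obtain rfl : m = m' := by omega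
    exact ⟨c, p, L, R, rfl, hg, e⟩
  · rintro ⟨c, p, L, R, rfl, hg, rfl⟩
    exact hg.mem_unimodalSet

theorem mem_staircaseSet_iff {m a b : ℕ} {w : List Step} : w ∈ staircaseSet m a b ↔
    ∃ p L R, b = p + m + 1 ∧ Grow (entered false) 0 a p m L R ∧ w = L.reverse ++ E :: R := by
  constructor
  · intro h
    obtain ⟨c, p, L, R, rfl, hg, rfl⟩ := mem_unimodalSet_iff.1 ⟨h.1.toIsUnimodal, h.2⟩
    cases c with
    | false => exact ⟨p, L, R, rfl, hg, rfl⟩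
    | true => exact absurd h hg.not_corner
  · rintro ⟨p, L, R, rfl, hg, rfl⟩
    exact hg.mem_staircaseSet

theorem ncard_staircaseSet (m a p : ℕ) :
    (staircaseSet m a (p + m + 1)).ncard = growCount (entered false) 0 a p m := by
  have : staircaseSet m a (p + m + 1) =
      (fun q : List Step × List Step => q.1.reverse ++ E :: q.2) ''
        growSet (entered false) 0 a p m := by
    ext w
    rw [mem_staircaseSet_iff]
    constructor
    · rintro ⟨p', L, R, hp, hg, rfl⟩
      obtain rfl : p = p' := by omega
      exact ⟨(L, R), hg, rfl⟩
    · rintro ⟨⟨L, R⟩, hg, rfl⟩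
      exact ⟨p, L, R, rfl, hg, rfl⟩
  rw [this, growCount]
  refine Set.InjOn.ncard_image fun q hq q' hq' e => ?_
  exact Prod.ext_iff.2 (Grow.unique hq hq' e)

theorem ncard_unimodalSet (m a p : ℕ) : (unimodalSet m a (p + m + 1)).ncard =
    growCount (entered false) 0 a p m + growCount (entered true) 0 a p m := by
  have : unimodalSet m a (p + m + 1) =
      (fun q : List Step × List Step => q.1.reverse ++ E :: q.2) ''
        (growSet (entered false) 0 a p m ∪ growSet (entered true) 0 a p m) := by
    ext w
    rw [mem_unimodalSet_iff]
    constructor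
    · rintro ⟨c, p', L, R, hp, hg, rfl⟩
      obtain rfl : p = p' := by omega
      refine ⟨(L, R), ?_, rfl⟩
      cases c
      · exact Or.inl hg
      · exact Or.inr hg
    · rintro ⟨⟨L, R⟩, hg | hg, rfl⟩
      · exact ⟨_, p, L, R, rfl, hg, rfl⟩
      · exact ⟨_, p, L, R, rfl, hg, rfl⟩
  rw [this, growCount, growCount, Set.InjOn.ncard_image,
    Set.ncard_union_eq ?_ (growSet_finite ..) (growSet_finite ..)]
  · rw [Set.disjoint_left]
    intro q h1 h2
    have h1 := (Grow.shape h1).2.2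
    have h2 := (Grow.shape h2).2.2
    simp_all
  · rintro q (hq | hq) q' (hq' | hq') e <;> exact Prod.ext_iff.2 (Grow.unique hq hq' e)

theorem coeff_y_pow_mul (k : ℕ) (f : Series) (e : Fin 2 →₀ ℕ) :
    MvPowerSeries.coeff e (y ^ k * f) =
      if k ≤ e 1 then MvPowerSeries.coeff (e - Finsupp.single 1 k) f else 0 := by
  classical
  rw [y, MvPowerSeries.X_pow_eq, MvPowerSeries.coeff_monomial_mul, one_mul]
  simp only [Finsupp.single_le_iff]

/-- In `growSeries` the variable `y` marks neither the first row nor the `m` rows with indents; the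
factor `y ^ (m + 1)` restores the full height. -/
theorem staircaseGF_eq (m : ℕ) :
    staircaseGF m = y ^ (m + 1) * PowerSeries.coeff m (growSeries (entered false) 0) := by
  ext e
  rw [coeff_y_pow_mul, coeff_growSeries]
  change ((staircaseSet m (e 0) (e 1)).ncard : ℚ) = _
  split_ifs with h
  · obtain ⟨p, hp⟩ := Nat.exists_eq_add_of_le h
    rw [hp, show m + 1 + p = p + m + 1 by omega, ncard_staircaseSet]
    simp [hp]
  · rw [show staircaseSet m (e 0) (e 1) = ∅ from ?_, Set.ncard_empty, Nat.cast_zero]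
    ext w
    rw [mem_staircaseSet_iff]
    simp only [Set.mem_empty_iff_false, iff_false]
    rintro ⟨p, L, R, hp, -⟩
    omega

theorem unimodalGF_eq (m : ℕ) : unimodalGF m = y ^ (m + 1) *
    PowerSeries.coeff m (growSeries (entered false) 0 + growSeries (entered true) 0) := by
  ext e
  rw [coeff_y_pow_mul, map_add, map_add, coeff_growSeries, coeff_growSeries]
  change ((unimodalSet m (e 0) (e 1)).ncard : ℚ) = _
  split_ifs with h
  · obtain ⟨p, hp⟩ := Nat.exists_eq_add_of_le h
    rw [hp, show m + 1 + p = p + m + 1 by omega, ncard_unimodalSet]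
    simp [hp]
  · rw [show unimodalSet m (e 0) (e 1) = ∅ from ?_, Set.ncard_empty, Nat.cast_zero]
    ext w
    rw [mem_unimodalSet_iff]
    simp only [Set.mem_empty_iff_false, iff_false]
    rintro ⟨c, p, L, R, hp, -⟩
    omega

end MConvex

theorem mainTheorem8 (m : ℕ) (hm : 1 ≤ m) :
    MConvex.staircaseGF m =
        MvPowerSeries.C (1 / (Nat.factorial m : ℚ)) * MConvex.y ^ (m + 1) *
          MConvex.dy^[m - 1] (MConvex.I ^ m * MConvex.dy (MConvex.divY MConvex.SP)) ∧
      MConvex.unimodalGF m =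
        MvPowerSeries.C (1 / (Nat.factorial m : ℚ)) * MConvex.y ^ (m + 1) *
          MConvex.dy^[m - 1] (MConvex.I ^ m * MConvex.dy (MConvex.divY MConvex.UP)) := by
  obtain ⟨k, rfl⟩ := Nat.exists_eq_add_of_le' hm
  rw [MConvex.staircaseGF_eq, MConvex.unimodalGF_eq, MConvex.coeff_growSeries_staircase,
    MConvex.coeff_growSeries_unimodal, Nat.add_sub_cancel]
  constructor <;> ring
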